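/- Spaces are simplicial sets. Let $J$ be any set of prime numbers, let $\mathbb N(J)\subset\mathbb N$ be the set of products of powers of primes in $J$ (so $1\in\mathbb N(J)$, $0\notin\mathbb N(J)$), and let $\mathbb Z[J^{-1}]=\mathbb Z[1/p : p\in J]\subseteq\mathbb Q$. Choose sequences $\underline n,\underline r$ as follows. There is one multi-index $0$ in layer $0$. To each multi-index $\ell$ occurring in layer $k$ one assigns an integer $n(\ell)\ge 0$ and an integer $r(\ell)\in\mathbb N(J)$, and $\ell$ then has the $2n(\ell)$ successors $(\ell,1),\dots,(\ell,2n(\ell))$ in layer $k+1$; all occurring multi-indices arise in this way (the process may or may not stop). Let $G(\underline r,\underline n)$ be the group with one generator $x(\ell)$ and one relator $$R(\ell)=x(\ell)^{r(\ell)}\prod_{j=1}^{n(\ell)}[x(\ell,2j-1),x(\ell,2j)]$$ for each occurring multi-index $\ell$, where $[a,b]=aba^{-1}b^{-1}$. Let $M(\underline r,\underline n)$ be its presentation complex: a wedge of circles, one for each generator, with one $2$-cell attached along each relator. Let $\Gamma$ be the free product of the groups $G(\underline r,\underline n)$, and let $\mathcal M$ be the wedge of the complexes $M(\underline r,\underline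 n)$, both over all possible choices of $(\underline r,\underline n)$. A pointed space $X$ is called a Moore space of type $M(G,1)$ if $\pi_1(X)\cong G$ and $\tilde H_i(X;\mathbb Z)=0$ for all $i\neq 1$; a space is $HR$-acyclic if it is non-empty and its reduced homology with coefficients in $R$ vanishes in all degrees. **Theorem.** 1. For every choice of $(\underline r,\underline n)$, the complex $M(\underline r,\underline n)$ is a Moore space of type $M(G(\underline r,\underline n),1)$; in particular $H_2(M(\underline r,\underline n);\mathbb Z)=0$. Every element of $H_1(M(\underline r,\underline n);\mathbb Z)$ is annihilated by some $m\in\mathbb N(J)$, and $M(\underline r,\underline n)$ is $H\mathbb Z[J^{-1}]$-acyclic. 2. The wedge $\mathcal M$ is a Moore space of type $M(\Gamma,1)$, it is $H\mathbb Z[J^{-1}]$-acyclic, and $H_1(\mathcal M;\mathbb Z)$ is isomorphic to a direct sum of cyclic groups $\mathbb Z/p^k$ with $p\in J$ and $k\ge 1$, in which $\mathbb Z/p^k$ occurs infinitely often for every $p\in J$ and every $k\geq 1$. -/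

import Mathlib

open CategoryTheory Limits Opposite
open scoped DirectSum

/-! ### Reduced homology and the fundamental group of a simplicial set -/

/-- The type of vertices (0-simplices) of a simplicial set. -/
abbrev SSet.Vertex (X : SSet.{0}) : Type := X.obj (op (SimplexCategory.mk 0))

/-- The homology `H_n(X; ℤ)` of a simplicial set. -/
noncomputable abbrev SSet.integralHomology (X : SSet.{0}) (n : ℕ) : ModuleCat.{0} ℤ :=
  X.homology (ModuleCat.of ℤ ℤ) n

/-- The reduced homology `H̃_n(X; R)` of a (non-empty) simplicial set: the kernel of the map
`H_n(X; R) ⟶ H_n(pt; R)` induced by the unique map from `X` to the point `Δ[0]`. -/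
noncomputable def SSet.reducedHomology (X : SSet.{0}) (R : Type) [CommRing R] (n : ℕ) :
    ModuleCat.{0} R :=
  kernel (SSet.homologyMap (SSet.stdSimplex.isTerminalObj₀.from X) (ModuleCat.of R R) n)

/-- `X` is `HR`-acyclic: it is non-empty and its reduced homology with coefficients in `R`
vanishes in all degrees. -/
def SSet.IsHomologyAcyclic (X : SSet.{0}) (R : Type) [CommRing R] : Prop :=
  Nonempty X.Vertex ∧ ∀ n : ℕ, IsZero (X.reducedHomology R n)

/-- The fundamental groupoid of a simplicial set (Gabriel–Zisman): objects are the vertices;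
morphisms are generated by the edges and their formal inverses, subject to the relations
given by degenerate edges and by 2-simplices. -/
abbrev SSet.FundamentalGroupoid (X : SSet.{0}) : Type :=
  FreeGroupoid ((SSet.truncation 2).obj X).HomotopyCategory

/-- The fundamental group of a simplicial set at a vertex. -/
abbrev SSet.FundamentalGroup (X : SSet.{0}) (x : X.Vertex) : Type :=
  Aut (show X.FundamentalGroupoid from
    FreeGroupoid.mk
      (SSet.Truncated.HomotopyCategory.mk (V := (SSet.truncation 2).obj X) x))

/-- `(X, x)` is a Moore space of type `M(G, 1)`: its fundamental group is isomorphic to `G`, and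
its integral reduced homology vanishes in all degrees except possibly in degree one. -/
def SSet.IsMooreSpace (X : SSet.{0}) (x : X.Vertex) (G : Type) [Group G] : Prop :=
  Nonempty (X.FundamentalGroup x ≃* G) ∧
    ∀ n : ℕ, n ≠ 1 → IsZero (X.reducedHomology ℤ n)

/-- The wedge of a family of pointed simplicial sets: the colimit of the base points
`Δ[0] ⟶ X i`, so that all base points are identified. -/
noncomputable def SSet.wedge {ι : Type} (X : ι → SSet.{0}) (x : ∀ i, (X i).Vertex) : SSet.{0} :=
  widePushout (SSet.stdSimplex.obj (SimplexCategory.mk 0)) X (fun i => SSet.yonedaEquiv.symm (x i))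

/-- The common base point of a wedge. -/
noncomputable def SSet.wedgePt {ι : Type} (X : ι → SSet.{0}) (x : ∀ i, (X i).Vertex) :
    (SSet.wedge X x).Vertex :=
  SSet.yonedaEquiv (WidePushout.head (fun i => SSet.yonedaEquiv.symm (x i)))

/-! ### Two-dimensional Δ-complexes and their simplicial sets -/

/-- The gluing data of a Δ-complex of dimension at most two: vertices, edges, triangles, with the
endpoints of an edge and the `j`-th face (opposite to the `j`-th vertex) of a triangle. -/
structure DeltaComplex2 where
  V : Type
  E : Type
  T : Type
  src : E → V
  tgt : E → V
  face : Fin 3 → T → E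
  src_face : ∀ t, src (face 2 t) = src (face 1 t)
  mid_face : ∀ t, tgt (face 2 t) = src (face 0 t)
  tgt_face : ∀ t, tgt (face 0 t) = tgt (face 1 t)

namespace DeltaComplex2

/-- The `n`-simplices of the disjoint union of the standard simplices
`∐_V Δ[0] ⊔ ∐_E Δ[1] ⊔ ∐_T Δ[2]`. -/
inductive Simplex (K : DeltaComplex2) (n : SimplexCategory) : Type
  | vert (v : K.V) : Simplex K n
  | edge (e : K.E) (f : n ⟶ (SimplexCategory.mk 1)) : Simplex K n
  | tri (t : K.T) (f : n ⟶ (SimplexCategory.mk 2)) : Simplex K n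

/-- The gluing relation: the faces of each edge and triangle are identified with the prescribed
vertices and edges. -/
inductive Glue (K : DeltaComplex2) (n : SimplexCategory) : K.Simplex n → K.Simplex n → Prop
  | tgt (e : K.E) (f : n ⟶ (SimplexCategory.mk 0)) :
      Glue K n (.edge e (f ≫ SimplexCategory.δ 0)) (.vert (K.tgt e))
  | src (e : K.E) (f : n ⟶ (SimplexCategory.mk 0)) :
      Glue K n (.edge e (f ≫ SimplexCategory.δ 1)) (.vert (K.src e))
  | face (t : K.T) (j : Fin 3) (f : n ⟶ (SimplexCategory.mk 1)) :
      Glue K n (.tri t (f ≫ SimplexCategory.δ j)) (.edge (K.face j t) f)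

/-- Restriction of a simplex along a map of the simplex category. -/
def Simplex.pull {K : DeltaComplex2} {m n : SimplexCategory} (g : m ⟶ n) :
    K.Simplex n → K.Simplex m
  | .vert v => .vert v
  | .edge e f => .edge e (g ≫ f)
  | .tri t f => .tri t (g ≫ f)

lemma Glue.pull {K : DeltaComplex2} {m n : SimplexCategory} (g : m ⟶ n) (a b : K.Simplex n)
    (h : K.Glue n a b) : K.Glue m (a.pull g) (b.pull g) := by
  cases h with
  | tgt e f => simpa [Simplex.pull] using Glue.tgt (K := K) e (g ≫ f)
  | src e f => simpa [Simplex.pull] using Glue.src (K := K) e (g ≫ f)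
  | face t j f => simpa [Simplex.pull] using Glue.face (K := K) t j (g ≫ f)

/-- The simplicial set presented by a Δ-complex: the quotient of
`∐_V Δ[0] ⊔ ∐_E Δ[1] ⊔ ∐_T Δ[2]` by the face identifications. -/
def toSSet (K : DeltaComplex2) : SSet.{0} where
  obj n := Quot (K.Glue n.unop)
  map g := ↾(Quot.map (Simplex.pull g.unop) (Glue.pull g.unop))
  map_id n := by
    ext ⟨x⟩
    cases x <;> simp [Quot.map, Simplex.pull]
  map_comp f g := by
    ext ⟨x⟩
    cases x <;> simp [Quot.map, Simplex.pull]

/-- A vertex of the Δ-complex, as a vertex of the simplicial set. -/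
def vertex (K : DeltaComplex2) (v : K.V) : K.toSSet.Vertex :=
  Quot.mk (K.Glue (SimplexCategory.mk 0)) (Simplex.vert v)

end DeltaComplex2

/-! ### Group presentations and presentation complexes -/

/-- A group presentation: generators, and relators given as non-empty words in the generators
(`(x, true)` stands for the letter `x`, and `(x, false)` for its inverse). -/
structure GroupPresentation where
  Gen : Type
  Rel : Type
  word : Rel → List (Gen × Bool)
  word_ne_nil : ∀ s, word s ≠ []

namespace GroupPresentation

/-- The group defined by a presentation. -/
abbrev group (P : GroupPresentation) : Type :=
  PresentedGroup (Set.range fun s => FreeGroup.mk (P.word s))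

/-- The corner at which the `i`-th side of a polygon with `L` sides ends:
the `i`-th side runs from the corner `i` to the corner `i + 1` modulo `L`. -/
def nextCorner {L : ℕ} (i : Fin L) : Fin L :=
  ⟨(i.val + 1) % L, Nat.mod_lt _ (Nat.zero_lt_of_lt i.isLt)⟩

/-- The cell structure of the presentation complex.
* Vertices: the base point `none`, and a centre `some s` for the 2-cell of each relator `s`.
* Edges: a loop `x` at the base point for each generator `x` (these form a wedge of circles), and,
  for each relator `s`, a spoke from the centre of its 2-cell to each corner of the polygon; all
  corners are mapped to the base point.
* Triangles: the 2-cell attached along the relator `s` is a polygon whose sides, read cyclically,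
  are glued to the loops as dictated by the successive letters of `word s`, a side labelled by an
  inverse letter being glued with the opposite orientation. The polygon is the cone over its
  boundary, so it consists of one triangle (centre and one side) for each letter. -/
def cells (P : GroupPresentation) : DeltaComplex2 where
  V := Option P.Rel
  E := P.Gen ⊕ (Σ s : P.Rel, Fin (P.word s).length)
  T := Σ s : P.Rel, Fin (P.word s).length
  src
    | .inl _ => none
    | .inr c => some c.1
  tgt _ := none
  face j t :=
    let letter := (P.word t.1).get t.2
    let c₀ : Σ s : P.Rel, Fin (P.word s).length := ⟨t.1, t.2⟩
    let c₁ : Σ s : P.Rel, Fin (P.word s).length := ⟨t.1, nextCorner t.2⟩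
    match j with
    | 0 => .inl letter.1
    | 1 => .inr (if letter.2 then c₁ else c₀)
    | 2 => .inr (if letter.2 then c₀ else c₁)
  src_face t := by
    dsimp only
    split <;> rfl
  mid_face t := rfl
  tgt_face t := rfl

/-- The presentation complex of a group presentation, as a simplicial set. -/
def complex (P : GroupPresentation) : SSet.{0} := P.cells.toSSet

/-- The base point of the presentation complex. -/
def basePt (P : GroupPresentation) : P.complex.Vertex := P.cells.vertex none

end GroupPresentation

/-! ### The groups `G(r, n)` and the complexes `M(r, n)` -/

/-- `ℕ(J)`: the natural numbers that are products of powers of primes in `J`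
(in particular `1` belongs to it and `0` does not). -/
def torsionNumbers (J : Set ℕ) : Set ℕ :=
  {m | m ≠ 0 ∧ ∀ p : ℕ, p.Prime → p ∣ m → p ∈ J}

/-- `ℤ[J⁻¹]`, as a subring of `ℚ`. -/
abbrev invertedIntegers (J : Set ℕ) : Subring ℚ :=
  Subring.closure {q : ℚ | ∃ p ∈ J, q = (p : ℚ)⁻¹}

/-- The multi-indices which occur for the numbers `n`. The multi-index `(k, i₁, …, i_k)` of the
`k`-th layer is encoded as the list `[i_k - 1, …, i₁ - 1]`; the index `0` is the empty list. An
index `l` has the `2 * n l` successors `i :: l`, `i < 2 * n l`, in the following layer. -/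
inductive IsIndex (n : List ℕ → ℕ) : List ℕ → Prop
  | root : IsIndex n []
  | succ {l : List ℕ} {i : ℕ} (h : IsIndex n l) (hi : i < 2 * n l) : IsIndex n (i :: l)

/-- A choice of sequences `r` and `n`: a natural number `n l` and a number `r l ∈ ℕ(J)` for each
occurring multi-index `l`. (For the other lists `n` has the value `0`, so that distinct terms of
this type are distinct choices.) -/
structure LayerSequences (J : Set ℕ) where
  n : List ℕ → ℕ
  n_eq_zero : ∀ l, ¬ IsIndex n l → n l = 0
  r : {l : List ℕ // IsIndex n l} → ℕ
  r_mem : ∀ l, r l ∈ torsionNumbers J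

namespace LayerSequences

variable {J : Set ℕ} (D : LayerSequences J)

/-- The set of occurring multi-indices, which labels both the generators and the relations. -/
abbrev Index : Type := {l : List ℕ // IsIndex D.n l}

/-- The successor `i` of a multi-index. -/
def child (l : D.Index) (i : ℕ) (hi : i < 2 * D.n l.1) : D.Index :=
  ⟨i :: l.1, IsIndex.succ l.2 hi⟩

/-- The word `[y_{2j}, y_{2j+1}]` in the successors `y_i` of `x(l)` (indices from `0`). -/
def commutatorWord (l : D.Index) (j : Fin (D.n l.1)) : List (D.Index × Bool) :=
  let a := D.child l (2 * j) (by omega)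
  let b := D.child l (2 * j + 1) (by omega)
  [(a, true), (b, true), (a, false), (b, false)]

/-- The relator `R(l) = x(l)^{r(l)} ∏_j [y_{2j}, y_{2j+1}]`, as a word. -/
def relatorWord (l : D.Index) : List (D.Index × Bool) :=
  List.replicate (D.r l) (l, true) ++ (List.finRange (D.n l.1)).flatMap (D.commutatorWord l)

/-- In the free group, the word `R(l)` is `x(l)^{r(l)} ∏_j [y_{2j}, y_{2j+1}]`, where
`[a, b] = a b a⁻¹ b⁻¹`. -/
lemma mk_relatorWord (l : D.Index) :
    FreeGroup.mk (D.relatorWord l) = FreeGroup.of l ^ D.r l *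
      ((List.finRange (D.n l.1)).map fun j : Fin (D.n l.1) =>
        let a := FreeGroup.of (D.child l (2 * j) (by omega))
        let b := FreeGroup.of (D.child l (2 * j + 1) (by omega))
        a * b * a⁻¹ * b⁻¹).prod := by
  have h1 : ∀ k : ℕ, FreeGroup.mk (List.replicate k (l, true)) = FreeGroup.of l ^ k := by
    intro k
    induction k with
    | zero => rfl
    | succ k ih => rw [List.replicate_succ, pow_succ', ← ih]; rfl
  have h2 : ∀ L : List (Fin (D.n l.1)), FreeGroup.mk (L.flatMap (D.commutatorWord l)) =
      (L.map fun j : Fin (D.n l.1) =>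
        let a := FreeGroup.of (D.child l (2 * j) (by omega))
        let b := FreeGroup.of (D.child l (2 * j + 1) (by omega))
        a * b * a⁻¹ * b⁻¹).prod := by
    intro L
    induction L with
    | nil => rfl
    | cons a L ih => rw [List.flatMap_cons, List.map_cons, List.prod_cons, ← ih]; rfl
  rw [relatorWord, ← FreeGroup.mul_mk, h1, h2]

/-- The presentation with a generator `x(l)` and a relator `R(l)` for each occurring index. -/
def presentation : GroupPresentation where
  Gen := D.Index
  Rel := D.Index
  word := D.relatorWord
  word_ne_nil l h := by
    have := (D.r_mem l).1
    simp [relatorWord] at h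
    exact this h.1

/-- The group `G(r, n)`. -/
abbrev G : Type := D.presentation.group

/-- The presentation complex `M(r, n)`. -/
def M : SSet.{0} := D.presentation.complex

/-- The base point of `M(r, n)`. -/
def basePt : D.M.Vertex := D.presentation.basePt

end LayerSequences

/-- The group `Γ_J`: the free product of all the groups `G(r, n)`. -/
abbrev universalGroup (J : Set ℕ) : Type :=
  Monoid.CoprodI fun D : LayerSequences J => D.G

/-- The space `𝓜_J`: the wedge of all the presentation complexes `M(r, n)`. -/
noncomputable def universalMooreSpace (J : Set ℕ) : SSet.{0} :=
  SSet.wedge (fun D : LayerSequences J => D.M) (fun D => D.basePt)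

/-- The base point of `𝓜_J`. -/
noncomputable def universalMooreSpacePt (J : Set ℕ) : (universalMooreSpace J).Vertex :=
  SSet.wedgePt (fun D : LayerSequences J => D.M) (fun D => D.basePt)

/-!
In a presentation complex each 2-cell is the cone over its boundary polygon, and the normalized
chains are the cellular chains, spanned by the vertices, edges and triangles. In the boundary of a
whole 2-cell the spokes from its centre cancel, so that homology is governed by one linear map,
`relatorMap`, which sends a relator to the vector of exponents of the generators in it: `H₂`
vanishes if this map is injective (`isZero_homology_two`), and `H₁` is its cokernel
(`nonempty_homology_one_equiv`). The complex is connected and of dimension two, so nothing else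
contributes to reduced homology.

For the presentation of `G(r, n)` the commutators have exponent zero, and `relatorMap` is the
diagonal matrix of the numbers `r(l) ∈ ℕ(J)`. It is injective over `ℤ` and over `ℤ[J⁻¹]`, and it is
bijective over `ℤ[J⁻¹]`, where the `r(l)` are units; over `ℤ` its cokernel is the direct sum of the
groups `ℤ/r(l)`, which the Chinese remainder theorem splits into groups of prime power order.

The fundamental group of a presentation complex is the presented group
(`nonempty_fundamentalGroup_equiv`). In one direction, the generators on the loops and the initial
segments of relators on the spokes form a 1-cocycle on the complex, hence define a functor from
the fundamental groupoid to the group. In the other direction, each generator is sent to its loop;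
the relators become trivial because the triangles move the first spoke once around the 2-cell. The
two are inverse to each other up to the paths from the base point along the first spokes.

No separate argument is needed for the wedge: the wedge of presentation complexes is the complex of
the disjoint union of the presentations (`wedgeIso`), whose group is the free product
(`sigmaGroupEquiv`) and whose relator map is again diagonal. The group `ℤ/q^e` occurs infinitely
often in its `H₁` because infinitely many choices of sequences have `r = q^e` at the root.
-/

open Simplicial

/-! ### Simplices and maps of the simplicial set of a Δ-complex -/

namespace DeltaComplex2

variable (K : DeltaComplex2)

/-- The 1-simplex of `K.toSSet` given by an edge of `K`. -/
def edge (e : K.E) : K.toSSet _⦋1⦌ := Quot.mk (K.Glue ⦋1⦌) (.edge e (𝟙 _))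

/-- The 2-simplex of `K.toSSet` given by a triangle of `K`. -/
def triangle (t : K.T) : K.toSSet _⦋2⦌ := Quot.mk (K.Glue ⦋2⦌) (.tri t (𝟙 _))

variable {K}

lemma map_mk {m n : SimplexCategory} (g : m ⟶ n) (s : K.Simplex n) :
    K.toSSet.map g.op (Quot.mk _ s) = Quot.mk _ (s.pull g) := rfl

lemma mk_vert {n : SimplexCategory} (v : K.V) (g : n ⟶ ⦋0⦌) :
    Quot.mk (K.Glue n) (.vert v) = K.toSSet.map g.op (K.vertex v) := rfl

lemma mk_edge {n : SimplexCategory} (e : K.E) (f : n ⟶ ⦋1⦌) :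
    Quot.mk (K.Glue n) (.edge e f) = K.toSSet.map f.op (K.edge e) := by
  refine Eq.trans ?_ (map_mk f (.edge e (𝟙 _))).symm
  simp [Simplex.pull]

lemma mk_tri {n : SimplexCategory} (t : K.T) (f : n ⟶ ⦋2⦌) :
    Quot.mk (K.Glue n) (.tri t f) = K.toSSet.map f.op (K.triangle t) := by
  refine Eq.trans ?_ (map_mk f (.tri t (𝟙 _))).symm
  simp [Simplex.pull]

@[simp]
lemma δ_one_edge (e : K.E) : K.toSSet.δ 1 (K.edge e) = K.vertex (K.src e) := by
  have := Quot.sound (Glue.src (K := K) e (𝟙 ⦋0⦌))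
  rw [mk_edge, Category.id_comp] at this
  exact this

@[simp]
lemma δ_zero_edge (e : K.E) : K.toSSet.δ 0 (K.edge e) = K.vertex (K.tgt e) := by
  have := Quot.sound (Glue.tgt (K := K) e (𝟙 ⦋0⦌))
  rw [mk_edge, Category.id_comp] at this
  exact this

@[simp]
lemma δ_triangle (t : K.T) (j : Fin 3) :
    K.toSSet.δ j (K.triangle t) = K.edge (K.face j t) := by
  have := Quot.sound (Glue.face (K := K) t j (𝟙 ⦋1⦌))
  rw [mk_tri, Category.id_comp] at this
  exact this

/-- Every simplex is obtained from a vertex, an edge or a triangle of the Δ-complex. -/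
lemma toSSet_cases {n : SimplexCategory} {motive : K.toSSet.obj (op n) → Prop}
    (vertex : ∀ v (g : n ⟶ ⦋0⦌), motive (K.toSSet.map g.op (K.vertex v)))
    (edge : ∀ e (g : n ⟶ ⦋1⦌), motive (K.toSSet.map g.op (K.edge e)))
    (triangle : ∀ t (g : n ⟶ ⦋2⦌), motive (K.toSSet.map g.op (K.triangle t)))
    (x : K.toSSet.obj (op n)) : motive x := by
  obtain ⟨s⟩ := x
  cases s with
  | vert v =>
    have := vertex v (SimplexCategory.isTerminalZero.from n)
    rwa [← mk_vert] at this
  | edge e f => have := edge e f; rwa [← mk_edge] at this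
  | tri t f => have := triangle t f; rwa [← mk_tri] at this

/-- The simplicial set of a Δ-complex is generated by the vertices, edges and triangles. -/
lemma toSSet_hom_ext {Y : SSet.{0}} {f g : K.toSSet ⟶ Y}
    (hv : ∀ v, f.app _ (K.vertex v) = g.app _ (K.vertex v))
    (he : ∀ e, f.app _ (K.edge e) = g.app _ (K.edge e))
    (ht : ∀ t, f.app _ (K.triangle t) = g.app _ (K.triangle t)) : f = g := by
  ext ⟨n⟩ x
  induction x using toSSet_cases with
  | vertex v h =>
    exact (NatTrans.naturality_apply f h.op _).trans
      (congr(Y.map _ $(hv _)).trans (NatTrans.naturality_apply g h.op _).symm)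
  | edge e h =>
    exact (NatTrans.naturality_apply f h.op _).trans
      (congr(Y.map _ $(he _)).trans (NatTrans.naturality_apply g h.op _).symm)
  | triangle t h =>
    exact (NatTrans.naturality_apply f h.op _).trans
      (congr(Y.map _ $(ht _)).trans (NatTrans.naturality_apply g h.op _).symm)

section desc

variable {Y : SSet.{0}} (v : K.V → Y _⦋0⦌) (e : K.E → Y _⦋1⦌) (t : K.T → Y _⦋2⦌)
  (hsrc : ∀ x, Y.δ 1 (e x) = v (K.src x)) (htgt : ∀ x, Y.δ 0 (e x) = v (K.tgt x))
  (hface : ∀ s (j : Fin 3), Y.δ j (t s) = e (K.face j s))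

/-- A map out of the simplicial set of a Δ-complex is given by compatible images of the vertices,
edges and triangles. -/
def toSSetDesc : K.toSSet ⟶ Y where
  app n := ↾(Quot.lift (fun s => match s with
    | .vert x => Y.map (SimplexCategory.isTerminalZero.from n.unop).op (v x)
    | .edge x f => Y.map f.op (e x)
    | .tri x f => Y.map f.op (t x)) (by
      rintro _ _ (⟨x, f⟩ | ⟨x, f⟩ | ⟨x, j, f⟩)
      · dsimp only
        rw [op_comp, Functor.map_comp_apply]
        exact congr(Y.map _ $(htgt x)).trans
          (by rw [Subsingleton.elim f (SimplexCategory.isTerminalZero.from n.unop)])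
      · dsimp only
        rw [op_comp, Functor.map_comp_apply]
        exact congr(Y.map _ $(hsrc x)).trans
          (by rw [Subsingleton.elim f (SimplexCategory.isTerminalZero.from n.unop)])
      · dsimp only
        rw [op_comp, Functor.map_comp_apply]
        exact congr(Y.map _ $(hface x j))))
  naturality n m g := by
    ext ⟨x⟩
    cases x with
    | vert x =>
      change Y.map _ _ = Y.map _ (Y.map _ _)
      rw [← Functor.map_comp_apply, ← Quiver.Hom.op_unop g, ← op_comp]
      congr 3
    | edge x f =>
      change Y.map (g.unop ≫ f).op _ = Y.map _ (Y.map _ _)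
      rw [← Functor.map_comp_apply]; rfl
    | tri x f =>
      change Y.map (g.unop ≫ f).op _ = Y.map _ (Y.map _ _)
      rw [← Functor.map_comp_apply]; rfl

@[simp]
lemma toSSetDesc_vertex (x : K.V) :
    (toSSetDesc v e t hsrc htgt hface).app _ (K.vertex x) = v x := by
  change Y.map (SimplexCategory.isTerminalZero.from ⦋0⦌).op (v x) = v x
  rw [SimplexCategory.isTerminalZero.hom_ext (SimplexCategory.isTerminalZero.from ⦋0⦌) (𝟙 _)]
  simp

@[simp]
lemma toSSetDesc_edge (x : K.E) :
    (toSSetDesc v e t hsrc htgt hface).app _ (K.edge x) = e x := by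
  change Y.map (𝟙 ⦋1⦌).op (e x) = e x
  simp

@[simp]
lemma toSSetDesc_triangle (x : K.T) :
    (toSSetDesc v e t hsrc htgt hface).app _ (K.triangle x) = t x := by
  change Y.map (𝟙 ⦋2⦌).op (t x) = t x
  simp

end desc

/-- The simplicial set of a Δ-complex has dimension at most two. -/
instance : K.toSSet.HasDimensionLT 3 where
  degenerate_eq_top n hn := by
    ext x
    simp only [Set.top_eq_univ, Set.mem_univ, iff_true]
    induction x using toSSet_cases with
    | vertex v g => exact ⟨0, by lia, g, _, rfl⟩
    | edge e g => exact ⟨1, by lia, g, _, rfl⟩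
    | triangle t g => exact ⟨2, by lia, g, _, rfl⟩

lemma δ_toOrderHom_apply {n : ℕ} (j : Fin (n + 2)) {m : SimplexCategory} (f : m ⟶ ⦋n⦌)
    (i : Fin (m.len + 1)) :
    (f ≫ SimplexCategory.δ j).toOrderHom i = j.succAbove (f.toOrderHom i) := rfl

/-- The extension of a function on the vertices of `K` to the 0-simplices of `K.toSSet`. A 0-simplex
of a standard simplex `Δ[n]` is read off from the value of the map `⦋0⦌ ⟶ ⦋n⦌` at `0`. With `c` the
identity, this shows that distinct vertices of `K` remain distinct in `K.toSSet`. -/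
def vertexLift {α : Type*} (c : K.V → α) : K.toSSet _⦋0⦌ → α :=
  Quot.lift (fun s => match s with
    | .vert v => c v
    | .edge e f => match f.toOrderHom 0 with
      | 0 => c (K.src e)
      | 1 => c (K.tgt e)
    | .tri t f => match f.toOrderHom 0 with
      | 0 => c (K.src (K.face 1 t))
      | 1 => c (K.src (K.face 0 t))
      | 2 => c (K.tgt (K.face 1 t))) (by
    rintro _ _ (⟨x, f⟩ | ⟨x, f⟩ | ⟨x, j, f⟩)
    · simp only [δ_toOrderHom_apply]
      generalize f.toOrderHom 0 = i
      change Fin 1 at i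
      fin_cases i; rfl
    · simp only [δ_toOrderHom_apply]
      generalize f.toOrderHom 0 = i
      change Fin 1 at i
      fin_cases i; rfl
    · simp only [δ_toOrderHom_apply]
      generalize f.toOrderHom 0 = i
      change Fin 2 at i
      have := K.src_face x
      have := K.mid_face x
      have := K.tgt_face x
      fin_cases i <;> fin_cases j <;> simp_all [Fin.succAbove])

/-- The extension of a function on the edges of `K` to the 1-simplices of `K.toSSet`, with the
constant value `a` on the degenerate 1-simplices. A 1-simplex of `Δ[n]` is read off from the values
of the map `⦋1⦌ ⟶ ⦋n⦌` at `0` and `1`. -/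
def edgeLift {α : Type*} (a : α) (c : K.E → α) : K.toSSet _⦋1⦌ → α :=
  Quot.lift (fun s => match s with
    | .vert _ => a
    | .edge e f => match f.toOrderHom 0, f.toOrderHom 1 with
      | 0, 1 => c e
      | _, _ => a
    | .tri t f => match f.toOrderHom 0, f.toOrderHom 1 with
      | 0, 1 => c (K.face 2 t)
      | 0, 2 => c (K.face 1 t)
      | 1, 2 => c (K.face 0 t)
      | _, _ => a) (by
    rintro _ _ (⟨x, f⟩ | ⟨x, f⟩ | ⟨x, j, f⟩)
    · simp only [δ_toOrderHom_apply]
      generalize f.toOrderHom 0 = i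
      generalize f.toOrderHom 1 = k
      change Fin 1 at i k
      fin_cases i; fin_cases k; rfl
    · simp only [δ_toOrderHom_apply]
      generalize f.toOrderHom 0 = i
      generalize f.toOrderHom 1 = k
      change Fin 1 at i k
      fin_cases i; fin_cases k; rfl
    · simp only [δ_toOrderHom_apply]
      generalize f.toOrderHom 0 = i
      generalize f.toOrderHom 1 = k
      change Fin 2 at i k
      fin_cases i <;> fin_cases k <;> fin_cases j <;> rfl)

@[simp]
lemma edgeLift_degenerate {α : Type*} (a : α) (c : K.E → α) (x : K.toSSet _⦋0⦌) :
    edgeLift a c (K.toSSet.σ 0 x) = a := by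
  obtain ⟨s⟩ := x
  have (n : ℕ) (f : ⦋0⦌ ⟶ ⦋n⦌) : (SimplexCategory.σ 0 ≫ f).toOrderHom 0 =
    (SimplexCategory.σ (0 : Fin 1) ≫ f).toOrderHom 1 := rfl
  cases s with
  | vert v => rfl
  | edge e f =>
    change (match (SimplexCategory.σ 0 ≫ f).toOrderHom 0,
      (SimplexCategory.σ 0 ≫ f).toOrderHom 1 with
      | 0, 1 => c e
      | _, _ => a) = a
    rw [this]
    generalize (SimplexCategory.σ 0 ≫ f).toOrderHom 1 = i
    change Fin 2 at i
    fin_cases i <;> rfl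
  | tri t f =>
    change (match (SimplexCategory.σ 0 ≫ f).toOrderHom 0,
      (SimplexCategory.σ 0 ≫ f).toOrderHom 1 with
      | 0, 1 => c (K.face 2 t)
      | 0, 2 => c (K.face 1 t)
      | 1, 2 => c (K.face 0 t)
      | _, _ => a) = a
    rw [this]
    generalize (SimplexCategory.σ 0 ≫ f).toOrderHom 1 = i
    change Fin 3 at i
    fin_cases i <;> rfl

/-- Every 0-simplex is given by a vertex of the Δ-complex. -/
lemma vertex_surjective : Function.Surjective K.vertex := by
  have key (e : K.E) (g : ⦋0⦌ ⟶ ⦋1⦌) : ∃ v, K.vertex v = K.toSSet.map g.op (K.edge e) := by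
    have : Mono g :=
      SimplexCategory.mono_iff_injective.2 fun i j _ => Subsingleton.elim (α := Fin 1) i j
    obtain ⟨i, rfl⟩ := SimplexCategory.eq_δ_of_mono g
    fin_cases i
    exacts [⟨_, (δ_zero_edge e).symm⟩, ⟨_, (δ_one_edge e).symm⟩]
  intro x
  induction x using toSSet_cases with
  | vertex v g =>
    rw [SimplexCategory.isTerminalZero.hom_ext g (𝟙 _)]
    exact ⟨v, by simp⟩
  | edge e g => exact key e g
  | triangle t g =>
    obtain ⟨j, θ, rfl⟩ := SimplexCategory.eq_comp_δ_of_not_surjective g fun h => by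
      have := Fintype.card_le_of_surjective _ h
      simp at this
    rw [op_comp, Functor.map_comp_apply]
    exact (key (K.face j t) θ).imp fun v hv =>
      hv.trans congr(K.toSSet.map θ.op $(δ_triangle t j)).symm

/-- Every 1-simplex is degenerate or given by an edge of the Δ-complex. -/
lemma edge_cases {motive : K.toSSet _⦋1⦌ → Prop}
    (degenerate : ∀ v, motive (K.toSSet.σ 0 (K.vertex v)))
    (edge : ∀ e, motive (K.edge e)) (x : K.toSSet _⦋1⦌) : motive x := by
  have key {n : ℕ} (g : ⦋1⦌ ⟶ ⦋n⦌) (y : K.toSSet _⦋n⦌)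
      (hg : ¬ Function.Injective g.toOrderHom) : motive (K.toSSet.map g.op y) := by
    obtain ⟨i, θ, rfl⟩ := SimplexCategory.eq_σ_comp_of_not_injective g hg
    obtain rfl : i = 0 := by fin_cases i; rfl
    obtain ⟨v, hv⟩ := vertex_surjective (K.toSSet.map θ.op y)
    rw [op_comp, Functor.map_comp_apply, ← hv]
    exact degenerate v
  induction x using toSSet_cases with
  | vertex v g =>
    exact key g _ fun h => by simpa using Fintype.card_le_of_injective _ h
  | edge e g =>
    by_cases hg : Function.Injective g.toOrderHom
    · have : Mono g := SimplexCategory.mono_iff_injective.2 hg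
      rw [SimplexCategory.eq_id_of_mono g]
      simpa using edge e
    · exact key g _ hg
  | triangle t g =>
    by_cases hg : Function.Injective g.toOrderHom
    · have : Mono g := SimplexCategory.mono_iff_injective.2 hg
      obtain ⟨j, rfl⟩ := SimplexCategory.eq_δ_of_mono g
      have := edge (K.face j t)
      rw [← δ_triangle] at this
      exact this
    · exact key g _ hg

/-- Every nondegenerate 2-simplex is given by a triangle of the Δ-complex. -/
lemma exists_triangle_of_nonDegenerate {x : K.toSSet _⦋2⦌} (hx : x ∈ K.toSSet.nonDegenerate 2) :
    ∃ t, K.triangle t = x := by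
  induction x using toSSet_cases with
  | vertex v g => exact absurd ⟨0, by lia, g, _, rfl⟩ hx
  | edge e g => exact absurd ⟨1, by lia, g, _, rfl⟩ hx
  | triangle t g =>
    by_cases hg : Function.Injective g.toOrderHom
    · have : Mono g := SimplexCategory.mono_iff_injective.2 hg
      rw [SimplexCategory.eq_id_of_mono g]
      exact ⟨t, by simp⟩
    · obtain ⟨i, θ, rfl⟩ := SimplexCategory.eq_σ_comp_of_not_injective g hg
      rw [op_comp, Functor.map_comp_apply] at hx
      exact absurd (K.toSSet.σ_mem_degenerate i _) hx

end DeltaComplex2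

/-! ### Homology and normalized chains -/

namespace ChainComplex

variable {R : Type} [CommRing R] (C : ChainComplex (ModuleCat.{0} R) ℕ)

lemma isZero_homology_of_injective {n : ℕ} (h : Function.Injective (C.d (n + 1) n).hom) :
    IsZero (C.homology (n + 1)) := by
  rw [← HomologicalComplex.exactAt_iff_isZero_homology,
    HomologicalComplex.exactAt_iff' C (n + 2) (n + 1) n (by simp) (by simp),
    ShortComplex.moduleCat_exact_iff]
  intro x hx
  have : x = 0 := h (hx.trans (map_zero (C.d (n + 1) n).hom).symm)
  exact ⟨0, by simp [this]⟩

/-- A linear map on `(n + 1)`-chains which vanishes on boundaries, maps the cycles onto `A`, and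
whose kernel on cycles consists of boundaries, identifies the homology with `A`. -/
lemma nonempty_homology_equiv {n : ℕ} {A : Type*} [AddCommGroup A] [Module R A]
    (q : C.X (n + 1) →ₗ[R] A) (hq : ∀ x, q ((C.d (n + 2) (n + 1)).hom x) = 0)
    (hsurj : ∀ a, ∃ z, (C.d (n + 1) n).hom z = 0 ∧ q z = a)
    (hker : ∀ z, (C.d (n + 1) n).hom z = 0 → q z = 0 → ∃ x, (C.d (n + 2) (n + 1)).hom x = z) :
    Nonempty (C.homology (n + 1) ≃ₗ[R] A) := by
  let S := C.sc' (n + 2) (n + 1) n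
  let e : C.homology (n + 1) ≅ S.moduleCatLeftHomologyData.H :=
    ShortComplex.homologyMapIso (C.isoSc' (n + 2) (n + 1) n (by simp) (by simp)) ≪≫
      S.moduleCatHomologyIso
  refine ⟨e.toLinearEquiv.trans (?_ :
    (LinearMap.ker S.g.hom ⧸ LinearMap.range S.moduleCatToCycles) ≃ₗ[R] A)⟩
  let q' : LinearMap.ker S.g.hom →ₗ[R] A := q ∘ₗ Submodule.subtype _
  refine (Submodule.quotEquivOfEq _ (LinearMap.ker q') ?_).trans
    (q'.quotKerEquivOfSurjective ?_)
  · ext ⟨z, hz⟩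
    constructor
    · rintro ⟨x, hx⟩
      have : S.f.hom x = z := congr(($hx).1)
      exact (congr(q $this)).symm.trans (hq x)
    · intro h
      obtain ⟨x, hx⟩ := hker z hz h
      exact ⟨x, Subtype.ext hx⟩
  · intro a
    obtain ⟨z, hz, rfl⟩ := hsurj a
    exact ⟨⟨z, hz⟩, rfl⟩

end ChainComplex

namespace SSet

variable (X : SSet.{0}) (R : Type) [CommRing R]

/-- The normalized chains of a simplicial set, with coefficients in a ring. -/
noncomputable abbrev normalizedChains : ChainComplex (ModuleCat.{0} R) ℕ :=
  X.normalizedChainComplex (ModuleCat.of R R)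

/-- The homology of a simplicial set is the homology of its normalized chains. -/
noncomputable def homologyIsoNormalized (n : ℕ) :
    X.homology (ModuleCat.of R R) n ≅ (X.normalizedChains R).homology n :=
  (X.homotopyEquivNormalizedChainComplex (ModuleCat.of R R)).toHomologyIso n

variable {X} {n : ℕ}

/-- The normalized chain given by a simplex; it vanishes if the simplex is degenerate. -/
noncomputable def normalizedChain (x : X _⦋n⦌) : (X.normalizedChains R).X n :=
  (X.ιNormalizedChainComplex (R := ModuleCat.of R R) x).hom (1 : R)

lemma normalizedChain_eq_zero {x : X _⦋n⦌} (hx : x ∈ X.degenerate n) :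
    normalizedChain R x = 0 := by
  simp [normalizedChain, ιNormalizedChainComplex_eq_zero _ _ hx]

lemma d_normalizedChain (x : X _⦋n + 1⦌) :
    ((X.normalizedChains R).d (n + 1) n).hom (normalizedChain R x) =
      ∑ i : Fin (n + 2), (-1 : ℤ) ^ i.val • normalizedChain R (X.δ i x) := by
  have := congr(($(X.ιNormalizedChainComplex_d (R := ModuleCat.of R R) x)).hom (1 : R))
  rw [ModuleCat.hom_comp, LinearMap.comp_apply] at this
  rw [normalizedChain, this, ModuleCat.hom_sum, LinearMap.sum_apply]
  rfl

/-- The normalized chains are spanned by the nondegenerate simplices. -/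
lemma span_normalizedChain :
    Submodule.span R (normalizedChain R '' X.nonDegenerate n) = ⊤ := by
  let S := Submodule.span R (normalizedChain R '' X.nonDegenerate n)
  have : ModuleCat.ofHom S.mkQ = 0 := by
    apply normalizedChainComplex_hom_ext
    intro x hx
    ext
    exact (Submodule.Quotient.mk_eq_zero S).2 (Submodule.subset_span (Set.mem_image_of_mem _ hx))
  rw [← Submodule.ker_mkQ (Submodule.span R _)]
  exact LinearMap.ker_eq_top.2 congr(($this).hom)

variable {R}

/-- A function on `n`-simplices which vanishes on degenerate simplices extends to a linear map on
normalized chains. -/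
lemma exists_normalizedChains_lift {A : Type} [AddCommGroup A] [Module R A] (c : X _⦋n⦌ → A)
    (hc : ∀ x ∈ X.degenerate n, c x = 0) :
    ∃ q : (X.normalizedChains R).X n →ₗ[R] A, ∀ x, q (normalizedChain R x) = c x := by
  let q : (X.normalizedChains R).X n ⟶ ModuleCat.of R A :=
    Cofan.IsColimit.desc (X.isColimitCofanNormalizedChainComplex (ModuleCat.of R R) n)
      (fun x => ModuleCat.ofHom (LinearMap.toSpanSingleton R A (c x.1)))
  refine ⟨q.hom, fun x => ?_⟩
  by_cases hx : x ∈ X.degenerate n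
  · rw [normalizedChain_eq_zero R hx, hc x hx, map_zero]
  · have : X.ιNormalizedChainComplex (R := ModuleCat.of R R) x ≫ q =
        ModuleCat.ofHom (LinearMap.toSpanSingleton R A (c x)) :=
      Cofan.IsColimit.fac (X.isColimitCofanNormalizedChainComplex (ModuleCat.of R R) n) _ ⟨x, hx⟩
    have := congr(($this).hom (1 : R))
    simpa using! this

end SSet

/-! ### The cellular chains of a Δ-complex -/

namespace DeltaComplex2

variable (K : DeltaComplex2) (R : Type) [CommRing R]

/-- The normalized chains of the simplicial set of a Δ-complex. They are spanned in each degree by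
the cells, so that they are the cellular chains. -/
noncomputable abbrev chains := K.toSSet.normalizedChains R

variable {K}

/-- The 0-chain given by a vertex. -/
noncomputable def vertexChain (v : K.V) : (K.chains R).X 0 := SSet.normalizedChain R (K.vertex v)

/-- The 1-chain given by an edge. -/
noncomputable def edgeChain (e : K.E) : (K.chains R).X 1 := SSet.normalizedChain R (K.edge e)

/-- The 2-chain given by a triangle. -/
noncomputable def triangleChain (t : K.T) : (K.chains R).X 2 :=
  SSet.normalizedChain R (K.triangle t)

@[simp]
lemma d_edgeChain (e : K.E) : ((K.chains R).d 1 0).hom (edgeChain R e) =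
    vertexChain R (K.tgt e) - vertexChain R (K.src e) := by
  rw [edgeChain, SSet.d_normalizedChain]
  simp [Fin.sum_univ_succ, vertexChain, sub_eq_add_neg]

@[simp]
lemma d_triangleChain (t : K.T) : ((K.chains R).d 2 1).hom (triangleChain R t) =
    edgeChain R (K.face 0 t) - edgeChain R (K.face 1 t) + edgeChain R (K.face 2 t) := by
  rw [triangleChain, SSet.d_normalizedChain]
  simp only [δ_triangle]
  refine (Fin.sum_univ_three _).trans ?_
  simp [edgeChain, sub_eq_add_neg]

lemma span_edgeChain : Submodule.span R (Set.range (edgeChain (K := K) R)) = ⊤ := by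
  rw [eq_top_iff, ← SSet.span_normalizedChain]
  apply Submodule.span_mono
  rintro _ ⟨x, hx, rfl⟩
  induction x using edge_cases with
  | degenerate v => exact absurd (K.toSSet.σ_mem_degenerate 0 _) hx
  | edge e => exact ⟨e, rfl⟩

lemma span_triangleChain : Submodule.span R (Set.range (triangleChain (K := K) R)) = ⊤ := by
  rw [eq_top_iff, ← SSet.span_normalizedChain]
  apply Submodule.span_mono
  rintro _ ⟨x, hx, rfl⟩
  obtain ⟨t, rfl⟩ := exists_triangle_of_nonDegenerate hx
  exact ⟨t, rfl⟩

variable {R} {A : Type} [AddCommGroup A] [Module R A]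

lemma exists_vertexChain_lift (c : K.V → A) :
    ∃ q : (K.chains R).X 0 →ₗ[R] A, ∀ v, q (vertexChain R v) = c v :=
  (SSet.exists_normalizedChains_lift (R := R) (vertexLift c) (by simp)).imp fun _ h v => h _

lemma exists_edgeChain_lift (c : K.E → A) :
    ∃ q : (K.chains R).X 1 →ₗ[R] A, ∀ e, q (edgeChain R e) = c e := by
  refine (SSet.exists_normalizedChains_lift (R := R) (edgeLift 0 c) fun x hx => ?_).imp
    fun _ h v => h _
  rw [SSet.degenerate_eq_iUnion_range_σ] at hx
  simp only [Set.mem_iUnion, Set.mem_range] at hx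
  obtain ⟨i, y, rfl⟩ := hx
  obtain rfl : i = 0 := by fin_cases i; rfl
  simp

end DeltaComplex2

/-! ### Homology of presentation complexes -/

namespace GroupPresentation

section words

variable {I : Type} (R : Type) [CommRing R]

/-- The exponent vector of a word: the total exponent of each letter. -/
noncomputable def exponents (w : List (I × Bool)) : I →₀ R :=
  (w.map fun l => Finsupp.single l.1 (if l.2 then 1 else -1)).sum

@[simp]
lemma exponents_nil : exponents R ([] : List (I × Bool)) = 0 := rfl

@[simp]
lemma exponents_append (w w' : List (I × Bool)) :
    exponents R (w ++ w') = exponents R w + exponents R w' := by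
  simp [exponents]

lemma exponents_singleton (l : I × Bool) :
    exponents R [l] = Finsupp.single l.1 (if l.2 then 1 else -1) := by
  simp [exponents]

lemma exponents_take_succ (w : List (I × Bool)) {i : ℕ} (hi : i < w.length) :
    exponents R (w.take (i + 1)) = exponents R (w.take i) + exponents R [w[i]] := by
  rw [← exponents_append, List.take_concat_get' _ _ hi]

lemma sum_exponents_get (w : List (I × Bool)) :
    ∑ i : Fin w.length, exponents R [w.get i] = exponents R w := by
  simp only [exponents_singleton, List.get_eq_getElem]
  rw [exponents]
  exact Fin.sum_univ_fun_getElem w fun l => Finsupp.single l.1 (if l.2 then 1 else -1)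

end words

variable (P : GroupPresentation) (R : Type) [CommRing R]

/-- The cellular boundary of the 2-cells: a relator is sent to its exponent vector. -/
noncomputable def relatorMap : (P.Rel →₀ R) →ₗ[R] (P.Gen →₀ R) :=
  Finsupp.linearCombination R fun s => exponents R (P.word s)

variable {P}

lemma nextCorner_of_lt {L : ℕ} {i : Fin L} (h : i.val + 1 < L) :
    nextCorner i = ⟨i.val + 1, h⟩ := by
  simp [nextCorner, Nat.mod_eq_of_lt h]

lemma nextCorner_of_eq {L : ℕ} {i : Fin L} (h : i.val + 1 = L) :
    nextCorner i = ⟨0, Nat.zero_lt_of_lt i.isLt⟩ := by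
  simp [nextCorner, h]

lemma nextCorner_injective {L : ℕ} : Function.Injective (nextCorner (L := L)) := by
  intro i j h
  have hi := i.isLt
  have hj := j.isLt
  by_cases h1 : i.val + 1 < L <;> by_cases h2 : j.val + 1 < L
  · rw [nextCorner_of_lt h1, nextCorner_of_lt h2] at h
    ext; simpa using h
  · rw [nextCorner_of_lt h1, nextCorner_of_eq (by omega)] at h
    simp at h
  · rw [nextCorner_of_eq (by omega), nextCorner_of_lt h2] at h
    simp at h
  · ext; omega

variable (P) in
/-- The sides of the 2-cells; a side also stands for the corner at which it starts. -/
abbrev Side : Type := Σ s : P.Rel, Fin (P.word s).length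

lemma word_length_pos (s : P.Rel) : 0 < (P.word s).length :=
  List.length_pos_iff.2 (P.word_ne_nil s)

/-- The loops of the presentation complex. -/
def loop (x : P.Gen) : P.cells.E := Sum.inl x

/-- The spoke from the centre of a 2-cell to one of its corners. -/
def spoke (c : P.Side) : P.cells.E := Sum.inr c

/-- The triangle over a side of a 2-cell. -/
def cone (c : P.Side) : P.cells.T := c

/-- The centre of a 2-cell. -/
def centre (s : P.Rel) : P.cells.V := some s

variable (P) in
/-- The base vertex, at which all corners of the 2-cells lie. -/
def base : P.cells.V := none

/-- The corner at which a side of a 2-cell ends. -/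
abbrev next (c : P.Side) : P.Side :=
  ⟨c.1, nextCorner c.2⟩

lemma next_injective : Function.Injective (next (P := P)) := by
  rintro ⟨s, i⟩ ⟨s', i'⟩ h
  obtain rfl : s = s' := congr($(h).1)
  simp only [Sigma.mk.injEq, heq_eq_eq, true_and] at h
  rw [nextCorner_injective h]

/-- The corner at which the boundary word of a 2-cell starts. -/
abbrev firstCorner (s : P.Rel) : P.Side := ⟨s, ⟨0, word_length_pos s⟩⟩

/-- The letter which labels a side of a 2-cell. -/
abbrev letter (c : P.Side) : P.Gen × Bool := (P.word c.1).get c.2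

lemma src_loop (x : P.Gen) : P.cells.src (loop x) = P.base := rfl
lemma tgt_loop (x : P.Gen) : P.cells.tgt (loop x) = P.base := rfl
lemma src_spoke (c : P.Side) : P.cells.src (spoke c) = centre c.1 := rfl
lemma tgt_spoke (c : P.Side) : P.cells.tgt (spoke c) = P.base := rfl
lemma face_zero_cone (c : P.Side) : P.cells.face 0 (cone c) = loop (letter c).1 := rfl
lemma face_one_cone (c : P.Side) :
    P.cells.face 1 (cone c) = spoke (if (letter c).2 then next c else c) := rfl
lemma face_two_cone (c : P.Side) :
    P.cells.face 2 (cone c) = spoke (if (letter c).2 then c else next c) := rfl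

variable {R} in
lemma exists_edgeChain_lift {A : Type} [AddCommGroup A] [Module R A]
    (f : P.Gen → A) (g : P.Side → A) :
    ∃ φ : (P.cells.chains R).X 1 →ₗ[R] A,
      (∀ x, φ (DeltaComplex2.edgeChain R (loop x)) = f x) ∧
      ∀ c, φ (DeltaComplex2.edgeChain R (spoke c)) = g c :=
  (DeltaComplex2.exists_edgeChain_lift (K := P.cells) (Sum.elim f g)).imp
    fun _ h => ⟨fun x => h (loop x), fun c => h (spoke c)⟩

/-- The 1-chain, in fact a cycle, given by a linear combination of generators: the corresponding
combination of loops. -/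
noncomputable def loopChain : (P.Gen →₀ R) →ₗ[R] (P.cells.chains R).X 1 :=
  Finsupp.linearCombination R fun x => DeltaComplex2.edgeChain R (loop x)

/-- The triangle with a given side, oriented so that its boundary runs along the side in the
direction of the boundary word. -/
noncomputable def orientedTriangle (c : P.Side) : (P.cells.chains R).X 2 :=
  (if (letter c).2 then (1 : R) else -1) • DeltaComplex2.triangleChain R (cone c)

/-- The boundary of the oriented triangle: its side, and the difference of the spokes to the two
ends of the side. Along a 2-cell the spokes telescope. -/
lemma d_orientedTriangle (c : P.Side) :
    ((P.cells.chains R).d 2 1).hom (orientedTriangle R c) =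
      loopChain R (exponents R [letter c]) + DeltaComplex2.edgeChain R (spoke c) -
        DeltaComplex2.edgeChain R (spoke (next c)) := by
  rw [orientedTriangle, map_smul, DeltaComplex2.d_triangleChain, exponents_singleton, loopChain,
    Finsupp.linearCombination_single]
  rw [face_zero_cone, face_one_cone, face_two_cone]
  split
  · simp only [one_smul]; abel
  · simp only [neg_smul, one_smul]; abel

lemma span_orientedTriangle :
    Submodule.span R (Set.range (orientedTriangle (P := P) R)) = ⊤ := by
  rw [eq_top_iff, ← DeltaComplex2.span_triangleChain, Submodule.span_le]
  rintro _ ⟨c, rfl⟩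
  have : DeltaComplex2.triangleChain R c =
      (if (letter (P := P) c).2 then (1 : R) else -1) • orientedTriangle R c := by
    unfold orientedTriangle; split <;> simp [cone]
  rw [this]
  exact Submodule.smul_mem _ _ (Submodule.subset_span ⟨c, rfl⟩)

lemma d_loopChain (v : P.Gen →₀ R) :
    ((P.cells.chains R).d 1 0).hom (loopChain R v) = 0 := by
  have : ((P.cells.chains R).d 1 0).hom ∘ₗ loopChain R = 0 := by
    refine Finsupp.lhom_ext' fun x => LinearMap.ext_ring ?_
    rw [LinearMap.comp_apply, LinearMap.comp_apply, loopChain, Finsupp.lsingle_apply,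
      Finsupp.linearCombination_single, one_smul, DeltaComplex2.d_edgeChain]
    rw [src_loop, tgt_loop, sub_self]; rfl
  exact congr($this v)

/-- The triangles over the first `i` sides of a 2-cell show that the spoke to the corner `i` is
homologous to the spoke to the first corner followed by the initial segment of length `i` of the
boundary word. -/
lemma exists_d_eq_loopChain (s : P.Rel) {i : ℕ} (hi : i < (P.word s).length) :
    ∃ x, ((P.cells.chains R).d 2 1).hom x = loopChain R (exponents R ((P.word s).take i)) +
      DeltaComplex2.edgeChain R (spoke (firstCorner s)) -
      DeltaComplex2.edgeChain R (spoke ⟨s, ⟨i, hi⟩⟩) := by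
  induction i with
  | zero => exact ⟨0, by simp⟩
  | succ i ih =>
    obtain ⟨x, hx⟩ := ih (by omega)
    refine ⟨x + orientedTriangle R ⟨s, ⟨i, by omega⟩⟩, ?_⟩
    rw [map_add, hx, d_orientedTriangle, exponents_take_succ R _ (by omega), map_add, next,
      nextCorner_of_lt hi]
    simp only [letter, List.get_eq_getElem]
    abel

/-- The sum of all triangles of a 2-cell has the exponent vector of the relator as boundary: the
spokes cancel, as the last side ends at the first corner. -/
lemma exists_d_eq_loopChain_relatorMap (b : P.Rel →₀ R) :
    ∃ x, ((P.cells.chains R).d 2 1).hom x = loopChain R (relatorMap P R b) := by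
  induction b using Finsupp.induction_linear with
  | zero => exact ⟨0, by simp⟩
  | add f g hf hg =>
    obtain ⟨x, hx⟩ := hf
    obtain ⟨y, hy⟩ := hg
    exact ⟨x + y, by simp only [map_add, hx, hy]⟩
  | single s a =>
    have hs := word_length_pos s
    obtain ⟨x, hx⟩ := exists_d_eq_loopChain R s (i := (P.word s).length - 1) (by omega)
    refine ⟨a • (x + orientedTriangle R ⟨s, ⟨(P.word s).length - 1, by omega⟩⟩), ?_⟩
    have h := exponents_take_succ R (P.word s) (i := (P.word s).length - 1) (by omega)
    rw [Nat.sub_add_cancel hs, List.take_length] at h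
    rw [map_smul, map_add, hx, d_orientedTriangle, next, nextCorner_of_eq (by simp; omega),
      relatorMap, Finsupp.linearCombination_single, h, map_smul, map_add]
    simp only [letter, List.get_eq_getElem]
    congr 1
    abel

/-- The second homology of a presentation complex vanishes if the exponent vectors of the relators
are linearly independent. -/
theorem isZero_homology_two (h : Function.Injective (relatorMap P R)) :
    IsZero (SSet.homology P.complex (ModuleCat.of R R) 2) := by
  refine IsZero.of_iso (ChainComplex.isZero_homology_of_injective _ ?_)
    (SSet.homologyIsoNormalized P.complex R 2)
  rw [← LinearMap.ker_eq_bot, LinearMap.ker_eq_bot']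
  intro z hz
  obtain ⟨u, rfl⟩ : ∃ u, Finsupp.linearCombination R (orientedTriangle (P := P) R) u = z := by
    have : z ∈ Submodule.span R (Set.range (orientedTriangle (P := P) R)) := by
      rw [span_orientedTriangle]; trivial
    rwa [← Finsupp.range_linearCombination] at this
  replace hz : ((P.cells.chains R).d 2 1).hom
    (Finsupp.linearCombination R (orientedTriangle (P := P) R) u) = 0 := hz
  -- The coefficients of the spokes show that `u` is constant on the sides of each 2-cell.
  obtain ⟨φ, hφ, hφ'⟩ := exists_edgeChain_lift (R := R) (P := P) (A := P.Side →₀ R)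
    (fun _ => 0) fun c => Finsupp.single c 1
  have hφu : φ ∘ₗ ((P.cells.chains R).d 2 1).hom ∘ₗ
      Finsupp.linearCombination R (orientedTriangle (P := P) R) =
      LinearMap.id - Finsupp.lmapDomain R R next := by
    refine Finsupp.lhom_ext' fun c => LinearMap.ext_ring ?_
    have h0 (v) : φ (loopChain R v) = 0 := by
      have : φ ∘ₗ loopChain R = 0 := by
        refine Finsupp.lhom_ext' fun x => LinearMap.ext_ring ?_
        simp [loopChain, hφ]
      exact congr($this v)
    simp [d_orientedTriangle, h0, hφ']
  have hnext (c) : u (next c) = u c := by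
    have h1 : u - Finsupp.mapDomain next u = 0 := by
      refine (congr($hφu u)).symm.trans ?_
      simp [hz]
    have h2 := congr($h1 (next c))
    rw [Finsupp.sub_apply, Finsupp.mapDomain_apply next_injective] at h2
    simpa [sub_eq_zero] using h2
  have hfirst (s : P.Rel) (i : ℕ) (hi : i < (P.word s).length) :
      u ⟨s, ⟨i, hi⟩⟩ = u (firstCorner s) := by
    induction i with
    | zero => rfl
    | succ i ih =>
      rw [← ih (by omega), ← hnext ⟨s, ⟨i, _⟩⟩, next, nextCorner_of_lt hi]
  -- The common values are the coefficients of a relation between the exponent vectors. The map `D`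
  -- sends a relator to the sum of the sides of its 2-cell.
  let v : P.Rel →₀ R := Finsupp.comapDomain firstCorner u
    fun s _ s' _ h => congr($(h).1)
  let D : (P.Rel →₀ R) →ₗ[R] (P.Side →₀ R) :=
    Finsupp.linearCombination R fun s => ∑ i, Finsupp.single ⟨s, i⟩ 1
  have hD (b : P.Rel →₀ R) (c : P.Side) : D b c = b c.1 := by
    have : Finsupp.lapply (R := R) c ∘ₗ D = Finsupp.lapply c.1 := by
      refine Finsupp.lhom_ext' fun s => LinearMap.ext_ring ?_
      classical
      obtain ⟨s', i⟩ := c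
      by_cases hs : s = s'
      · subst hs
        simp [D, Finsupp.single_apply]
      · simp [D, hs]
    exact congr($this b)
  have hDv : D v = u := by
    ext ⟨s, i⟩
    rw [hD, hfirst s i.1 i.2]
    rfl
  obtain ⟨ψ, hψ, hψ'⟩ := exists_edgeChain_lift (R := R) (P := P) (A := P.Gen →₀ R)
    (fun x => Finsupp.single x 1) fun _ => 0
  have hψD : ψ ∘ₗ ((P.cells.chains R).d 2 1).hom ∘ₗ
      Finsupp.linearCombination R (orientedTriangle (P := P) R) ∘ₗ D = relatorMap P R := by
    have h0 (v) : ψ (loopChain R v) = v := by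
      have : ψ ∘ₗ loopChain R = LinearMap.id := by
        refine Finsupp.lhom_ext' fun x => LinearMap.ext_ring ?_
        simp [loopChain, hψ]
      exact congr($this v)
    refine Finsupp.lhom_ext' fun s => LinearMap.ext_ring ?_
    simp only [LinearMap.comp_apply, Finsupp.lsingle_apply, D, Finsupp.linearCombination_single,
      map_sum, one_smul, d_orientedTriangle, map_add, map_sub, h0, hψ', relatorMap]
    simp only [add_zero, sub_zero, letter, sum_exponents_get]
  have hv : v = 0 := h (by
    rw [← hψD, map_zero]
    simp only [LinearMap.comp_apply, hDv, hz, map_zero])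
  rw [← hDv, hv, map_zero, map_zero]
  rfl

/-- The first homology of a presentation complex is the cokernel of the relator map. -/
theorem nonempty_homology_one_equiv {A : Type} [AddCommGroup A] [Module R A]
    (q : (P.Gen →₀ R) →ₗ[R] A) (hq : Function.Surjective q)
    (hker : LinearMap.ker q = LinearMap.range (relatorMap P R)) :
    Nonempty ((SSet.homology P.complex (ModuleCat.of R R) 1 : ModuleCat R) ≃ₗ[R] A) := by
  have hrel (s : P.Rel) : q (exponents R (P.word s)) = 0 := by
    have : exponents R (P.word s) ∈ LinearMap.ker q := by
      rw [hker]
      exact ⟨Finsupp.single s 1, by simp [relatorMap]⟩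
    exact this
  -- Since the spoke to a corner is homologous, relative to the spoke to the first corner, to the
  -- initial segment of the boundary word up to that corner, `q` is extended to 1-chains by the
  -- exponents of these initial segments.
  obtain ⟨φ, hφ, hφ'⟩ := exists_edgeChain_lift (R := R) (P := P)
    (fun x => q (Finsupp.single x 1)) fun c => q (exponents R ((P.word c.1).take c.2))
  have hφl (v) : φ (loopChain R v) = q v := by
    have : φ ∘ₗ loopChain R = q := by
      refine Finsupp.lhom_ext' fun x => LinearMap.ext_ring ?_
      simp [loopChain, hφ]
    exact congr($this v)
  have hφd' : φ ∘ₗ ((P.cells.chains R).d 2 1).hom = 0 := by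
    refine LinearMap.ext_on (span_orientedTriangle R) ?_
    rintro _ ⟨⟨s, i⟩, rfl⟩
    have h := exponents_take_succ R (P.word s) i.2
    rw [LinearMap.comp_apply, d_orientedTriangle]
    simp only [map_add, map_sub, hφ', hφl, LinearMap.zero_apply, letter, List.get_eq_getElem]
    rcases Nat.lt_or_ge (i.val + 1) (P.word s).length with hi | hi
    · rw [nextCorner_of_lt hi, h, map_add]
      abel
    · have hi' : i.val + 1 = (P.word s).length := by omega
      rw [nextCorner_of_eq hi']
      rw [hi', List.take_length] at h
      have := hrel s
      rw [h, map_add] at this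
      simpa [add_comm] using this
  have hφd (x) : φ (((P.cells.chains R).d 2 1).hom x) = 0 := congr($hφd' x)
  refine (ChainComplex.nonempty_homology_equiv (P.cells.chains R) (n := 0) φ hφd ?_ ?_).map
    fun e => (SSet.homologyIsoNormalized P.complex R 1).toLinearEquiv.trans e
  · intro a
    obtain ⟨v, rfl⟩ := hq a
    exact ⟨loopChain R v, d_loopChain R v, hφl v⟩
  · intro z hz hφz
    -- Modulo boundaries, the chain is a sum of loops and of spokes to first corners.
    let S : (P.Rel →₀ R) →ₗ[R] (P.cells.chains R).X 1 :=
      Finsupp.linearCombination R fun s => DeltaComplex2.edgeChain R (spoke (firstCorner s))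
    have htop : LinearMap.range ((P.cells.chains R).d 2 1).hom ⊔
        (LinearMap.range (loopChain (P := P) R) ⊔ LinearMap.range S) = ⊤ := by
      rw [eq_top_iff, ← DeltaComplex2.span_edgeChain, Submodule.span_le]
      rintro _ ⟨x | ⟨s, i⟩, rfl⟩
      · exact Submodule.mem_sup_right (Submodule.mem_sup_left
          ⟨Finsupp.single x 1, by simp [loopChain, loop]⟩)
      · obtain ⟨y, hy⟩ := exists_d_eq_loopChain R s i.2
        have : DeltaComplex2.edgeChain R (spoke (P := P) ⟨s, i⟩) =
            -((P.cells.chains R).d 2 1).hom y + (loopChain R (exponents R ((P.word s).take i)) +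
              S (Finsupp.single s 1)) := by
          rw [hy]
          simp [S]
        exact this ▸ Submodule.add_mem_sup (neg_mem ⟨y, rfl⟩)
          (Submodule.add_mem_sup ⟨_, rfl⟩ ⟨_, rfl⟩)
    obtain ⟨_, ⟨x, rfl⟩, _, hw, rfl⟩ := Submodule.mem_sup.1 (htop ▸ Submodule.mem_top (x := z))
    obtain ⟨_, ⟨v, rfl⟩, _, ⟨b, rfl⟩, rfl⟩ := Submodule.mem_sup.1 hw
    -- No spokes to first corners occur in a cycle, as their boundaries contain the centres.
    obtain ⟨χ, hχ⟩ := DeltaComplex2.exists_vertexChain_lift (R := R) (K := P.cells)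
      fun v => match v with
        | none => (0 : P.Rel →₀ R)
        | some s => Finsupp.single s 1
    have hχS : χ ∘ₗ ((P.cells.chains R).d 1 0).hom ∘ₗ S = -LinearMap.id := by
      refine Finsupp.lhom_ext' fun s => LinearMap.ext_ring ?_
      have h0 : χ (DeltaComplex2.vertexChain R P.base) = 0 := hχ none
      have h1 : χ (DeltaComplex2.vertexChain R (centre s)) = Finsupp.single s 1 := hχ (some s)
      simp [S, h0, h1, src_spoke, tgt_spoke]
    have hb : b = 0 := by
      have h1 : χ (((P.cells.chains R).d 1 0).hom (S b)) = -b := congr($hχS b)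
      have h2 : ((P.cells.chains R).d 1 0).hom (((P.cells.chains R).d 2 1).hom x) = 0 :=
        congr(($((P.cells.chains R).d_comp_d 2 1 0)).hom x)
      rw [map_add, map_add, h2, d_loopChain, zero_add, zero_add] at hz
      rw [hz, map_zero] at h1
      exact neg_eq_zero.1 h1.symm
    have hφx : φ (((P.cells.chains R).d 2 1).hom x) = 0 := hφd x
    rw [hb, map_zero, add_zero, map_add, hφx, zero_add, hφl] at hφz
    obtain ⟨b', rfl⟩ : v ∈ LinearMap.range (relatorMap P R) := hker ▸ hφz
    obtain ⟨y, hy⟩ := exists_d_eq_loopChain_relatorMap R b'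
    exact ⟨x + y, by rw [hb, map_zero, add_zero, map_add, ← hy]⟩

end GroupPresentation

/-! ### The fundamental group of a presentation complex -/

namespace SSet

variable (X : SSet.{0})

/-- A vertex as an object of the fundamental groupoid. -/
abbrev fundamentalPt (x : X.Vertex) : X.FundamentalGroupoid :=
  FreeGroupoid.mk (Truncated.HomotopyCategory.mk (V := (truncation 2).obj X) x)

variable {X}

/-- The morphism of the fundamental groupoid given by an edge. -/
abbrev Edge.path {x y : X.Vertex} (e : X.Edge x y) : X.fundamentalPt x ⟶ X.fundamentalPt y :=
  FreeGroupoid.homMk (Truncated.HomotopyCategory.homMk e.toTruncated)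

lemma Edge.path_comp_path {x y z : X.Vertex} {e₀₁ : X.Edge x y} {e₁₂ : X.Edge y z}
    {e₀₂ : X.Edge x z} (h : Edge.CompStruct e₀₁ e₁₂ e₀₂) : e₀₁.path ≫ e₁₂.path = e₀₂.path := by
  rw [Edge.path, Edge.path, ← Functor.map_comp,
    Truncated.HomotopyCategory.homMk_comp_homMk h.toTruncated]

lemma Edge.path_id (x : X.Vertex) : (Edge.id x).path = 𝟙 (X.fundamentalPt x) :=
  (congrArg (FreeGroupoid.of _).map (Truncated.HomotopyCategory.homMk_id _)).trans
    (CategoryTheory.Functor.map_id _ _)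

end SSet

namespace DeltaComplex2

variable {K : DeltaComplex2} {G : Type} [Group G]

/-- The cocycle condition on the triangles of `K` implies the one on all 2-simplices, where
degenerate edges have the value `1`. -/
lemma edgeLift_mul (c : K.E → G) (hc : ∀ t, c (K.face 2 t) * c (K.face 0 t) = c (K.face 1 t))
    (s : K.toSSet _⦋2⦌) :
    edgeLift 1 c (K.toSSet.δ 2 s) * edgeLift 1 c (K.toSSet.δ 0 s) =
      edgeLift 1 c (K.toSSet.δ 1 s) := by
  obtain ⟨s⟩ := s
  cases s with
  | vert v => exact one_mul _
  | edge e f =>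
    change (match f.toOrderHom 0, f.toOrderHom 1 with
      | 0, 1 => c e
      | _, _ => 1) * (match f.toOrderHom 1, f.toOrderHom 2 with
      | 0, 1 => c e
      | _, _ => 1) = (match f.toOrderHom 0, f.toOrderHom 2 with
      | 0, 1 => c e
      | _, _ => 1)
    have h01 := f.toOrderHom.monotone (show (0 : Fin 3) ≤ 1 by decide)
    have h12 := f.toOrderHom.monotone (show (1 : Fin 3) ≤ 2 by decide)
    revert h01 h12
    generalize f.toOrderHom 0 = i
    generalize f.toOrderHom 1 = j
    generalize f.toOrderHom 2 = k
    change Fin 2 at i j k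
    intro h01 h12
    fin_cases i <;> fin_cases j <;> fin_cases k <;> simp at h01 h12 ⊢
  | tri t f =>
    change (match f.toOrderHom 0, f.toOrderHom 1 with
      | 0, 1 => c (K.face 2 t)
      | 0, 2 => c (K.face 1 t)
      | 1, 2 => c (K.face 0 t)
      | _, _ => 1) * (match f.toOrderHom 1, f.toOrderHom 2 with
      | 0, 1 => c (K.face 2 t)
      | 0, 2 => c (K.face 1 t)
      | 1, 2 => c (K.face 0 t)
      | _, _ => 1) = (match f.toOrderHom 0, f.toOrderHom 2 with
      | 0, 1 => c (K.face 2 t)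
      | 0, 2 => c (K.face 1 t)
      | 1, 2 => c (K.face 0 t)
      | _, _ => 1)
    have h01 := f.toOrderHom.monotone (show (0 : Fin 3) ≤ 1 by decide)
    have h12 := f.toOrderHom.monotone (show (1 : Fin 3) ≤ 2 by decide)
    revert h01 h12
    generalize f.toOrderHom 0 = i
    generalize f.toOrderHom 1 = j
    generalize f.toOrderHom 2 = k
    change Fin 3 at i j k
    intro h01 h12
    fin_cases i <;> fin_cases j <;> fin_cases k <;> simp [hc] at h01 h12 ⊢

/-- A 1-cocycle of a Δ-complex with values in a group defines a functor on the fundamental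
groupoid. As composition in `SingleObj G` is multiplication in the opposite order, an edge is sent
to the inverse of its value. -/
def cocycleFunctor (c : K.E → G) (hc : ∀ t, c (K.face 2 t) * c (K.face 0 t) = c (K.face 1 t)) :
    K.toSSet.FundamentalGroupoid ⥤ SingleObj G :=
  FreeGroupoid.lift <| SSet.Truncated.HomotopyCategory.lift (fun _ => SingleObj.star G)
    (map := fun {x y} (e : SSet.Truncated.Edge (X := (SSet.truncation 2).obj K.toSSet) x y) =>
      ((edgeLift 1 c (SSet.Edge.ofTruncated (X := K.toSSet) e).edge)⁻¹ : G))
    (fun x => by exact inv_eq_one.2 (edgeLift_degenerate 1 c x))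
    (fun {_ _ _ e₀₁ e₁₂ e₀₂} h => by
      let H : SSet.Edge.CompStruct (X := K.toSSet) (.ofTruncated e₀₁) (.ofTruncated e₁₂)
        (.ofTruncated e₀₂) := h
      have h' := edgeLift_mul c hc H.simplex
      rw [H.d₀, H.d₁, H.d₂] at h'
      rw [SingleObj.comp_as_mul, ← mul_inv_rev, h'])

lemma cocycleFunctor_map_path (c : K.E → G)
    (hc : ∀ t, c (K.face 2 t) * c (K.face 0 t) = c (K.face 1 t)) {x y : K.toSSet.Vertex}
    (e : K.toSSet.Edge x y) :
    (cocycleFunctor c hc).map e.path = ((edgeLift 1 c e.edge)⁻¹ : G) := by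
  rw [cocycleFunctor, FreeGroupoid.lift_map_homMk]
  exact Category.id_comp (obj := SingleObj G) _

end DeltaComplex2

namespace GroupPresentation

variable {P : GroupPresentation}

/-- The element of the presented group given by an initial segment of the boundary of a 2-cell. -/
def prefixElement (c : P.Side) : P.group :=
  PresentedGroup.mk _ (FreeGroup.mk ((P.word c.1).take c.2))

/-- At the last side the index wraps around to `0`; the formula persists because the whole word is
trivial in the presented group. -/
lemma prefixElement_next (c : P.Side) : prefixElement (next c) =
    prefixElement c * PresentedGroup.mk _ (FreeGroup.mk [letter c]) := by
  obtain ⟨s, i⟩ := c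
  rw [prefixElement, prefixElement, ← map_mul, FreeGroup.mul_mk, letter, List.get_eq_getElem,
    List.take_concat_get' _ _ i.2]
  dsimp only
  rcases Nat.lt_or_ge (i.val + 1) (P.word s).length with hi | hi
  · rw [nextCorner_of_lt hi]
  · have hi' : i.val + 1 = (P.word s).length := by omega
    rw [nextCorner_of_eq hi', hi', List.take_length, List.take_zero]
    exact (PresentedGroup.one_of_mem (rels := Set.range fun s => FreeGroup.mk (P.word s))
      ⟨s, rfl⟩).symm

/-- The 1-cocycle of the presentation complex with the generators as values on the loops, and with
the initial segments of the relators as values on the spokes. -/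
def cocycle : P.cells.E → P.group := Sum.elim PresentedGroup.of prefixElement

lemma cocycle_loop (x : P.Gen) : cocycle (loop x) = PresentedGroup.of x := rfl

lemma cocycle_spoke (c : P.Side) : cocycle (spoke c) = prefixElement c := rfl

lemma cocycle_face (t : P.cells.T) :
    cocycle (P.cells.face 2 t) * cocycle (P.cells.face 0 t) = cocycle (P.cells.face 1 t) := by
  suffices h : ∀ c, cocycle (P.cells.face 2 (cone c)) * cocycle (P.cells.face 0 (cone c)) =
    cocycle (P.cells.face 1 (cone c)) from h t
  intro c
  rw [face_zero_cone, face_one_cone, face_two_cone, cocycle_loop, cocycle_spoke, cocycle_spoke]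
  have h := prefixElement_next c
  rcases h' : letter c with ⟨x, _ | _⟩
  · rw [h'] at h
    simp only [Bool.false_eq_true, if_false]
    rw [h, mul_assoc]
    refine (congrArg _ ?_).trans (mul_one _)
    exact inv_mul_cancel (PresentedGroup.of x)
  · rw [h'] at h
    simp only [if_true]
    exact h.symm

/-- A loop of the presentation complex as an edge. -/
def loopEdge (x : P.Gen) : P.cells.toSSet.Edge (P.cells.vertex P.base) (P.cells.vertex P.base) :=
  .mk (P.cells.edge (loop x)) (DeltaComplex2.δ_one_edge _) (DeltaComplex2.δ_zero_edge _)

/-- A spoke of the presentation complex as an edge. -/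
def spokeEdge (s : P.Rel) (i : Fin (P.word s).length) :
    P.cells.toSSet.Edge (P.cells.vertex (centre s)) (P.cells.vertex P.base) :=
  .mk (P.cells.edge (spoke ⟨s, i⟩)) (DeltaComplex2.δ_one_edge _) (DeltaComplex2.δ_zero_edge _)

/-- The automorphism of the base point given by a letter of a word. It is written in the group
`End`, where multiplication is composition in the opposite order, whence the inverse. -/
noncomputable def loopEnd (x : P.Gen) :
    End (P.cells.toSSet.fundamentalPt (P.cells.vertex P.base)) :=
  ((loopEdge x).path : End (P.cells.toSSet.fundamentalPt (P.cells.vertex P.base)))⁻¹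

/-- A triangle relates the spokes to the two ends of its side by the letter of the side. -/
lemma spoke_path_next (s : P.Rel) (i : Fin (P.word s).length) :
    (spokeEdge s i).path ≫ ((FreeGroup.lift loopEnd (FreeGroup.mk [letter ⟨s, i⟩]))⁻¹ : End _) =
      (spokeEdge s (nextCorner i)).path := by
  have hc := DeltaComplex2.δ_triangle (cone ⟨s, i⟩)
  rw [FreeGroup.lift_mk]
  rcases h' : letter ⟨s, i⟩ with ⟨x, _ | _⟩
  · have h : (spokeEdge s (nextCorner i)).path ≫ (loopEdge x).path = (spokeEdge s i).path := by
      refine SSet.Edge.path_comp_path (.mk (P.cells.triangle (cone ⟨s, i⟩)) ?_ ?_ ?_)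
      · rw [hc, face_two_cone, h']; rfl
      · rw [hc, face_zero_cone, h']; rfl
      · rw [hc, face_one_cone, h']; rfl
    simp only [List.map_cons, List.map_nil, List.prod_singleton, cond_false, inv_inv]
    rw [← h, Category.assoc]
    exact (congrArg _ (Groupoid.comp_inv _)).trans (Category.comp_id _)
  · have h : (spokeEdge s i).path ≫ (loopEdge x).path = (spokeEdge s (nextCorner i)).path := by
      refine SSet.Edge.path_comp_path (.mk (P.cells.triangle (cone ⟨s, i⟩)) ?_ ?_ ?_)
      · rw [hc, face_two_cone, h']; rfl
      · rw [hc, face_zero_cone, h']; rfl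
      · rw [hc, face_one_cone, h']; rfl
    simp only [List.map_cons, List.map_nil, List.prod_singleton, cond_true, loopEnd, inv_inv]
    exact h

/-- The spoke to the corner `i` is the first spoke followed by the initial segment of length `i` of
the boundary word. -/
lemma spoke_path (s : P.Rel) {i : ℕ} (hi : i < (P.word s).length) :
    (spokeEdge s ⟨0, word_length_pos s⟩).path ≫
      ((FreeGroup.lift loopEnd (FreeGroup.mk ((P.word s).take i)))⁻¹ : End _) =
      (spokeEdge s ⟨i, hi⟩).path := by
  induction i with
  | zero =>
    rw [List.take_zero, ← FreeGroup.one_eq_mk, map_one, inv_one]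
    exact Category.comp_id _
  | succ i ih =>
    have h := spoke_path_next s ⟨i, by omega⟩
    rw [nextCorner_of_lt hi] at h
    rw [← h, ← ih (by omega), Category.assoc, ← End.mul_def, ← mul_inv_rev, ← map_mul,
      FreeGroup.mul_mk, letter, List.get_eq_getElem, List.take_concat_get' _ _ (by omega)]

/-- Going once around a 2-cell, from the first spoke back to itself, kills the relator. -/
lemma lift_loopEnd_eq_one (s : P.Rel) : FreeGroup.lift loopEnd (FreeGroup.mk (P.word s)) = 1 := by
  have hs := word_length_pos s
  have h := spoke_path_next s ⟨(P.word s).length - 1, by omega⟩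
  rw [← spoke_path, nextCorner_of_eq (by simp; omega), Category.assoc, ← End.mul_def,
    ← mul_inv_rev, ← map_mul, FreeGroup.mul_mk, letter, List.get_eq_getElem,
    List.take_concat_get' _ _ (by omega), Nat.sub_add_cancel hs, List.take_length] at h
  rw [← inv_eq_one]
  rw [← cancel_epi (spokeEdge s ⟨0, word_length_pos s⟩).path]
  exact h.trans (Category.comp_id _).symm

/-- The homomorphism from the presented group to the automorphisms of the base point. -/
noncomputable def toEnd :
    P.group →* End (P.cells.toSSet.fundamentalPt (P.cells.vertex P.base)) :=
  PresentedGroup.toGroup (f := loopEnd) (by rintro _ ⟨s, rfl⟩; exact lift_loopEnd_eq_one s)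

/-- The functor from the fundamental groupoid to the presented group given by `cocycle`. -/
noncomputable def labelFunctor : P.cells.toSSet.FundamentalGroupoid ⥤ SingleObj P.group :=
  DeltaComplex2.cocycleFunctor cocycle cocycle_face

lemma labelFunctor_map_loopEdge (x : P.Gen) :
    labelFunctor.map (loopEdge x).path = ((PresentedGroup.of x : P.group)⁻¹ : P.group) :=
  DeltaComplex2.cocycleFunctor_map_path _ _ _

lemma labelFunctor_map_spokeEdge (s : P.Rel) (i : Fin (P.word s).length) :
    labelFunctor.map (spokeEdge s i).path = ((prefixElement ⟨s, i⟩)⁻¹ : P.group) :=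
  DeltaComplex2.cocycleFunctor_map_path _ _ _

lemma labelFunctor_map_toEnd (g : P.group) : labelFunctor.map (toEnd g) = g := by
  let φ : P.group →* P.group :=
    ((labelFunctor.mapEnd (P.cells.toSSet.fundamentalPt (P.cells.vertex P.base))).comp toEnd :)
  suffices h : φ = MonoidHom.id _ from congr($h g)
  ext x
  change labelFunctor.map (toEnd (PresentedGroup.of x)) = PresentedGroup.of x
  rw [toEnd, PresentedGroup.toGroup.of]
  change labelFunctor.map (Groupoid.inv (loopEdge x).path) = _
  rw [Groupoid.inv_eq_inv, Functor.map_inv, SingleObj.inv_as_inv]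
  exact (congrArg _ (labelFunctor_map_loopEdge x)).trans (inv_inv (PresentedGroup.of x))

/-- A path from the base point to any vertex: constant at the base point, and the inverse of the
first spoke at the centre of a 2-cell. -/
noncomputable def pathTo (v : P.cells.V) : P.cells.toSSet.fundamentalPt (P.cells.vertex P.base) ≅
    P.cells.toSSet.fundamentalPt (P.cells.vertex v) :=
  match v with
  | none => Iso.refl _
  | some s => (asIso (spokeEdge s ⟨0, word_length_pos s⟩).path).symm

/-- The functors `labelFunctor` and `toEnd` compose to a functor isomorphic to the identity of the
fundamental groupoid, by the paths `pathTo`. Hence `labelFunctor` is faithful. -/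
lemma exists_natIso : ∃ e : labelFunctor (P := P) ⋙ SingleObj.functor toEnd ≅ 𝟭 _,
    e.hom.app (P.cells.toSSet.fundamentalPt (P.cells.vertex P.base)) = 𝟙 _ := by
  have hv (x : P.cells.toSSet.Vertex) :
      P.cells.vertex (DeltaComplex2.vertexLift (K := P.cells) id x) = x := by
    obtain ⟨v, rfl⟩ := DeltaComplex2.vertex_surjective x
    rfl
  let γ (x : P.cells.toSSet.Vertex) : P.cells.toSSet.fundamentalPt (P.cells.vertex P.base) ≅
      P.cells.toSSet.fundamentalPt x :=
    pathTo (DeltaComplex2.vertexLift (K := P.cells) id x) ≪≫ eqToIso (by rw [hv])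
  have γ_vertex (v) : γ (P.cells.vertex v) = pathTo v := Iso.trans_refl _
  -- Naturality of `γ` has to be checked on the edges only.
  have key (z : P.cells.toSSet _⦋1⦌) {x y : P.cells.toSSet.Vertex} (e : P.cells.toSSet.Edge x y)
      (he : e.edge = z) : (toEnd (labelFunctor.map e.path) : _ ⟶ _) ≫ (γ y).hom =
        (γ x).hom ≫ e.path := by
    induction z using DeltaComplex2.edge_cases with
    | degenerate v =>
      obtain rfl : P.cells.vertex v = x := by
        rw [← e.src_eq, he]; exact (SSet.Edge.id (P.cells.vertex v)).src_eq.symm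
      obtain rfl : P.cells.vertex v = y := by
        rw [← e.tgt_eq, he]; exact (SSet.Edge.id (P.cells.vertex v)).tgt_eq.symm
      obtain rfl : e = .id (P.cells.vertex v) := by ext; exact he
      rw [SSet.Edge.path_id, labelFunctor.map_id, Category.comp_id]
      exact (congrArg (· ≫ _) (map_one toEnd)).trans (Category.id_comp _)
    | edge a =>
      rcases a with a | ⟨s, i⟩
      · obtain rfl : P.cells.vertex P.base = x := by
          rw [← e.src_eq, he]; exact (DeltaComplex2.δ_one_edge (K := P.cells) (loop a)).symm
        obtain rfl : P.cells.vertex P.base = y := by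
          rw [← e.tgt_eq, he]; exact (DeltaComplex2.δ_zero_edge _).symm
        obtain rfl : e = loopEdge a := by ext; exact he
        rw [γ_vertex, labelFunctor_map_loopEdge, map_inv, toEnd, PresentedGroup.toGroup.of,
          loopEnd, inv_inv]
        exact (Category.comp_id _).trans (Category.id_comp _).symm
      · obtain rfl : P.cells.vertex (centre s) = x := by
          rw [← e.src_eq, he]; exact (DeltaComplex2.δ_one_edge (K := P.cells) (spoke ⟨s, i⟩)).symm
        obtain rfl : P.cells.vertex P.base = y := by
          rw [← e.tgt_eq, he]; exact (DeltaComplex2.δ_zero_edge _).symm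
        obtain rfl : e = spokeEdge s i := by ext; exact he
        rw [γ_vertex, γ_vertex, labelFunctor_map_spokeEdge, map_inv, ← spoke_path s i.2]
        change _ ≫ 𝟙 _ = inv (spokeEdge s ⟨0, word_length_pos s⟩).path ≫ _ ≫ _
        rw [IsIso.inv_hom_id_assoc, Category.comp_id]
        rfl
  exact ⟨FreeGroupoid.liftNatIso _ _ (SSet.Truncated.HomotopyCategory.mkNatIso
    (fun x => γ x) (fun x y e => key _ (.ofTruncated e) rfl)), by
      rw [FreeGroupoid.liftNatIso_hom_app]
      exact congr(Iso.hom $(γ_vertex P.base))⟩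

/-- The fundamental group of the presentation complex is the presented group. -/
theorem nonempty_fundamentalGroup_equiv (P : GroupPresentation) :
    Nonempty (P.complex.FundamentalGroup P.basePt ≃* P.group) := by
  let φ : Aut (P.cells.toSSet.fundamentalPt (P.cells.vertex P.base)) →* P.group :=
    { toFun := fun a => labelFunctor.map a.hom
      map_one' := labelFunctor.map_id _
      map_mul' := fun a b => labelFunctor.map_comp b.hom a.hom }
  refine ⟨(MulEquiv.ofBijective φ ⟨fun a b hab => ?_, fun g => ?_⟩ :)⟩
  · obtain ⟨e, he⟩ := exists_natIso (P := P)
    have h (a : Aut (P.cells.toSSet.fundamentalPt (P.cells.vertex P.base))) :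
        (toEnd (φ a) : _ ⟶ _) = a.hom := by
      have h := e.hom.naturality a.hom
      rw [he] at h
      exact (Category.comp_id _).symm.trans (h.trans (Category.id_comp _))
    ext
    rw [← h a, hab, h b]
  · exact ⟨(Groupoid.isoEquivHom _ _).symm (toEnd g), labelFunctor_map_toEnd g⟩

end GroupPresentation

/-! ### Wedges and disjoint unions of presentations -/

namespace SSet

variable {ι : Type} (X : ι → SSet.{0}) (x : ∀ i, (X i).Vertex)

/-- The inclusion of a summand in a wedge. -/
noncomputable def wedgeIncl (i : ι) : X i ⟶ wedge X x :=
  WidePushout.ι (fun i => yonedaEquiv.symm (x i)) i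

lemma wedgeIncl_pt (i : ι) : (wedgeIncl X x i).app _ (x i) = wedgePt X x := by
  have := WidePushout.arrow_ι (fun i => yonedaEquiv.symm (x i)) i
  rw [yonedaEquiv_symm_comp] at this
  exact (Equiv.symm_apply_eq _).1 this

variable {X x} {Y : SSet.{0}}

section

variable (y : Y.Vertex) (f : ∀ i, X i ⟶ Y) (hf : ∀ i, (f i).app _ (x i) = y)

/-- A family of pointed maps induces a map out of the wedge. -/
noncomputable def wedgeDesc : wedge X x ⟶ Y :=
  WidePushout.desc (yonedaEquiv.symm y) f fun i => by
    rw [yonedaEquiv_symm_comp]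
    exact congrArg _ (hf i)

lemma wedgeIncl_wedgeDesc (i : ι) : wedgeIncl X x i ≫ wedgeDesc y f hf = f i :=
  WidePushout.ι_desc ..

lemma wedgeDesc_pt : (wedgeDesc y f hf).app _ (wedgePt X x) = y := by
  have h := WidePushout.head_desc (fun i => yonedaEquiv.symm (x i)) (yonedaEquiv.symm y) f
    (fun i => by
      rw [yonedaEquiv_symm_comp]
      exact congrArg _ (hf i))
  have h' := congrArg yonedaEquiv h
  rw [Equiv.apply_symm_apply] at h'
  exact h'

end

lemma wedge_hom_ext {f g : wedge X x ⟶ Y} (hpt : f.app _ (wedgePt X x) = g.app _ (wedgePt X x))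
    (h : ∀ i, wedgeIncl X x i ≫ f = wedgeIncl X x i ≫ g) : f = g :=
  WidePushout.hom_ext _ _ _ h (yonedaEquiv.injective hpt)

end SSet

namespace GroupPresentation

section desc

variable {P : GroupPresentation} {Y : SSet.{0}} (y : Y _⦋0⦌) (z : P.Rel → Y _⦋0⦌)
  (l : P.Gen → Y _⦋1⦌) (s : P.Side → Y _⦋1⦌) (t : P.Side → Y _⦋2⦌)
  (hl₁ : ∀ x, Y.δ 1 (l x) = y) (hl₀ : ∀ x, Y.δ 0 (l x) = y)
  (hs₁ : ∀ c, Y.δ 1 (s c) = z c.1) (hs₀ : ∀ c, Y.δ 0 (s c) = y)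
  (ht₀ : ∀ c, Y.δ 0 (t c) = l (letter c).1)
  (ht₁ : ∀ c, Y.δ 1 (t c) = s (if (letter c).2 then next c else c))
  (ht₂ : ∀ c, Y.δ 2 (t c) = s (if (letter c).2 then c else next c))

/-- A map out of a presentation complex is given by compatible images of the base point, the
centres of the 2-cells, the loops, the spokes and the triangles. -/
def complexDesc : P.complex ⟶ Y :=
  DeltaComplex2.toSSetDesc (K := P.cells)
    (fun v => match v with
      | none => y
      | some r => z r)
    (Sum.elim l s) t
    (fun e => by
      rcases e with x | c
      exacts [hl₁ x, hs₁ c])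
    (fun e => by
      rcases e with x | c
      exacts [hl₀ x, hs₀ c])
    (fun c j => by
      fin_cases j
      exacts [ht₀ c, ht₁ c, ht₂ c])

lemma complexDesc_basePt : (complexDesc y z l s t hl₁ hl₀ hs₁ hs₀ ht₀ ht₁ ht₂).app _
    (P.cells.vertex P.base) = y := DeltaComplex2.toSSetDesc_vertex ..

lemma complexDesc_centre (r : P.Rel) : (complexDesc y z l s t hl₁ hl₀ hs₁ hs₀ ht₀ ht₁ ht₂).app _
    (P.cells.vertex (centre r)) = z r := DeltaComplex2.toSSetDesc_vertex ..

lemma complexDesc_loop (x : P.Gen) : (complexDesc y z l s t hl₁ hl₀ hs₁ hs₀ ht₀ ht₁ ht₂).app _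
    (P.cells.edge (loop x)) = l x := DeltaComplex2.toSSetDesc_edge ..

lemma complexDesc_spoke (c : P.Side) : (complexDesc y z l s t hl₁ hl₀ hs₁ hs₀ ht₀ ht₁ ht₂).app _
    (P.cells.edge (spoke c)) = s c := DeltaComplex2.toSSetDesc_edge ..

lemma complexDesc_cone (c : P.Side) : (complexDesc y z l s t hl₁ hl₀ hs₁ hs₀ ht₀ ht₁ ht₂).app _
    (P.cells.triangle (cone c)) = t c := DeltaComplex2.toSSetDesc_triangle ..

lemma complex_hom_ext {f g : P.complex ⟶ Y}
    (hb : f.app _ (P.cells.vertex P.base) = g.app _ (P.cells.vertex P.base))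
    (hc : ∀ r, f.app _ (P.cells.vertex (centre r)) = g.app _ (P.cells.vertex (centre r)))
    (hl : ∀ x, f.app _ (P.cells.edge (loop x)) = g.app _ (P.cells.edge (loop x)))
    (hs : ∀ c, f.app _ (P.cells.edge (spoke c)) = g.app _ (P.cells.edge (spoke c)))
    (ht : ∀ c, f.app _ (P.cells.triangle (cone c)) = g.app _ (P.cells.triangle (cone c))) :
    f = g := by
  refine DeltaComplex2.toSSet_hom_ext (K := P.cells) (fun v => ?_) (fun e => ?_) ht
  · rcases v with _ | r
    exacts [hb, hc r]
  · rcases e with x | c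
    exacts [hl x, hs c]

end desc

variable {ι : Type} (P : ι → GroupPresentation)

/-- The presentation of a free product: the disjoint union of presentations. -/
def sigma : GroupPresentation where
  Gen := Σ i, (P i).Gen
  Rel := Σ i, (P i).Rel
  word s := ((P s.1).word s.2).map fun l => (⟨s.1, l.1⟩, l.2)
  word_ne_nil s h := (P s.1).word_ne_nil s.2 (List.map_eq_nil_iff.1 h)

variable {P}

lemma length_word_sigma (s : (sigma P).Rel) :
    ((sigma P).word s).length = ((P s.1).word s.2).length := List.length_map _

/-- The inclusion of the sides of one presentation in the sides of the disjoint union. -/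
def sideIncl (i : ι) (c : (P i).Side) : (sigma P).Side :=
  ⟨⟨i, c.1⟩, c.2.cast (length_word_sigma (P := P) ⟨i, c.1⟩).symm⟩

/-- A side of a disjoint union as a side of one of the presentations. -/
def sideProj (c : (sigma P).Side) : (P c.1.1).Side := ⟨c.1.2, c.2.cast (length_word_sigma c.1)⟩

lemma exists_sideIncl_eq (c : (sigma P).Side) : ∃ i c', sideIncl i c' = c :=
  ⟨c.1.1, sideProj c, rfl⟩

lemma letter_sideIncl (i : ι) (c : (P i).Side) :
    letter (sideIncl i c) = (⟨i, (letter c).1⟩, (letter c).2) := by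
  simp only [letter, sideIncl, sigma, List.get_eq_getElem, List.getElem_map]
  rfl

lemma next_sideIncl (i : ι) (c : (P i).Side) : next (sideIncl i c) = sideIncl i (next c) := by
  refine Sigma.ext rfl (heq_of_eq (Fin.ext ?_))
  change (c.2.val + 1) % ((sigma P).word ⟨i, c.1⟩).length = (c.2.val + 1) % _
  exact congrArg _ (length_word_sigma (P := P) ⟨i, c.1⟩)

variable (P) in
/-- The inclusion of a presentation complex in the complex of a disjoint union. -/
def complexIncl (i : ι) : (P i).complex ⟶ (sigma P).complex :=
  complexDesc (Y := (sigma P).cells.toSSet) ((sigma P).cells.vertex (sigma P).base)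
    (fun r => (sigma P).cells.vertex (centre (P := sigma P) ⟨i, r⟩))
    (fun x => (sigma P).cells.edge (loop (P := sigma P) ⟨i, x⟩))
    (fun c => (sigma P).cells.edge (spoke (sideIncl i c)))
    (fun c => (sigma P).cells.triangle (cone (sideIncl i c)))
    (fun _ => DeltaComplex2.δ_one_edge _) (fun _ => DeltaComplex2.δ_zero_edge _)
    (fun _ => DeltaComplex2.δ_one_edge _) (fun _ => DeltaComplex2.δ_zero_edge _)
    (fun c => by rw [DeltaComplex2.δ_triangle, face_zero_cone, letter_sideIncl])
    (fun c => by
      rw [DeltaComplex2.δ_triangle, face_one_cone, letter_sideIncl, next_sideIncl]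
      split <;> rfl)
    (fun c => by
      rw [DeltaComplex2.δ_triangle, face_two_cone, letter_sideIncl, next_sideIncl]
      split <;> rfl)

lemma complexIncl_basePt (i : ι) : (complexIncl P i).app _ ((P i).cells.vertex (P i).base) =
    (sigma P).cells.vertex (sigma P).base :=
  complexDesc_basePt (P := P i) ..

lemma complexIncl_centre (i : ι) (r : (P i).Rel) :
    (complexIncl P i).app _ ((P i).cells.vertex (centre r)) =
      (sigma P).cells.vertex (centre (P := sigma P) ⟨i, r⟩) :=
  complexDesc_centre (P := P i) ..

lemma complexIncl_loop (i : ι) (x : (P i).Gen) :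
    (complexIncl P i).app _ ((P i).cells.edge (loop x)) =
      (sigma P).cells.edge (loop (P := sigma P) ⟨i, x⟩) :=
  complexDesc_loop (P := P i) ..

lemma complexIncl_spoke (i : ι) (c : (P i).Side) :
    (complexIncl P i).app _ ((P i).cells.edge (spoke c)) =
      (sigma P).cells.edge (spoke (sideIncl i c)) :=
  complexDesc_spoke (P := P i) ..

lemma complexIncl_cone (i : ι) (c : (P i).Side) :
    (complexIncl P i).app _ ((P i).cells.triangle (cone c)) =
      (sigma P).cells.triangle (cone (sideIncl i c)) :=
  complexDesc_cone (P := P i) ..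

section sigmaDesc

variable {Y : SSet.{0}} (y : Y _⦋0⦌) (f : ∀ i, (P i).complex ⟶ Y)
  (hf : ∀ i, (f i).app _ ((P i).cells.vertex (P i).base) = y)

/-- Families of simplices indexed by the sides of each presentation, as one family indexed by the
sides of the disjoint union. -/
def sideFamily {n : ℕ} (g : ∀ i, (P i).Side → Y _⦋n⦌) (c : (sigma P).Side) : Y _⦋n⦌ :=
  g c.1.1 (sideProj c)

/-- Pointed maps out of the presentation complexes extend to the complex of a disjoint union. -/
def sigmaDesc : (sigma P).complex ⟶ Y :=
  complexDesc (P := sigma P) y (fun r => (f r.1).app _ ((P r.1).cells.vertex (centre r.2)))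
    (fun x => (f x.1).app _ ((P x.1).cells.edge (loop x.2)))
    (sideFamily fun i c => (f i).app _ ((P i).cells.edge (spoke c)))
    (sideFamily fun i c => (f i).app _ ((P i).cells.triangle (cone c)))
    (fun x => ((f x.1).naturality_apply (SimplexCategory.δ 1).op _).symm.trans
      ((congrArg _ (DeltaComplex2.δ_one_edge _)).trans (hf x.1)))
    (fun x => ((f x.1).naturality_apply (SimplexCategory.δ 0).op _).symm.trans
      ((congrArg _ (DeltaComplex2.δ_zero_edge _)).trans (hf x.1)))
    (fun c => ((f c.1.1).naturality_apply (SimplexCategory.δ 1).op _).symm.trans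
      (congrArg _ (DeltaComplex2.δ_one_edge _)))
    (fun c => ((f c.1.1).naturality_apply (SimplexCategory.δ 0).op _).symm.trans
      ((congrArg _ (DeltaComplex2.δ_zero_edge _)).trans (hf c.1.1)))
    (fun c => by
      obtain ⟨i, c, rfl⟩ := exists_sideIncl_eq c
      rw [letter_sideIncl]
      exact ((f i).naturality_apply (SimplexCategory.δ 0).op _).symm.trans
        (congrArg _ (DeltaComplex2.δ_triangle _ 0)))
    (fun c => by
      obtain ⟨i, c, rfl⟩ := exists_sideIncl_eq c
      rw [letter_sideIncl, next_sideIncl]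
      refine ((f i).naturality_apply (SimplexCategory.δ 1).op _).symm.trans
        ((congrArg _ (DeltaComplex2.δ_triangle _ 1)).trans ?_)
      refine (congrArg (fun a => (f i).app _ ((P i).cells.edge a)) (face_one_cone c)).trans ?_
      dsimp only
      cases (letter c).2 <;> rfl)
    (fun c => by
      obtain ⟨i, c, rfl⟩ := exists_sideIncl_eq c
      rw [letter_sideIncl, next_sideIncl]
      refine ((f i).naturality_apply (SimplexCategory.δ 2).op _).symm.trans
        ((congrArg _ (DeltaComplex2.δ_triangle _ 2)).trans ?_)
      refine (congrArg (fun a => (f i).app _ ((P i).cells.edge a)) (face_two_cone c)).trans ?_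
      dsimp only
      cases (letter c).2 <;> rfl)

lemma sigmaDesc_basePt : (sigmaDesc y f hf).app _ ((sigma P).cells.vertex (sigma P).base) = y :=
  complexDesc_basePt (P := sigma P) ..

lemma complexIncl_sigmaDesc (i : ι) : complexIncl P i ≫ sigmaDesc y f hf = f i := by
  apply complex_hom_ext
  · exact (congrArg ((sigmaDesc y f hf).app _) (complexIncl_basePt i)).trans
      ((sigmaDesc_basePt y f hf).trans (hf i).symm)
  · exact fun r => (congrArg ((sigmaDesc y f hf).app _) (complexIncl_centre i r)).trans
      (complexDesc_centre (P := sigma P) ..)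
  · exact fun x => (congrArg ((sigmaDesc y f hf).app _) (complexIncl_loop i x)).trans
      (complexDesc_loop (P := sigma P) ..)
  · exact fun c => (congrArg ((sigmaDesc y f hf).app _) (complexIncl_spoke i c)).trans
      (complexDesc_spoke (P := sigma P) ..)
  · exact fun c => (congrArg ((sigmaDesc y f hf).app _) (complexIncl_cone i c)).trans
      (complexDesc_cone (P := sigma P) ..)

end sigmaDesc

/-- The complex of a disjoint union is generated by the complexes of the presentations and the base
point, which is needed for the empty family. -/
lemma sigma_hom_ext {Y : SSet.{0}} {f g : (sigma P).complex ⟶ Y}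
    (hb : f.app _ (sigma P).basePt = g.app _ (sigma P).basePt)
    (h : ∀ i, complexIncl P i ≫ f = complexIncl P i ≫ g) : f = g := by
  have key (i : ι) (n : ℕ) (a : (P i).complex _⦋n⦌) (b : (sigma P).complex _⦋n⦌)
      (hab : (complexIncl P i).app _ a = b) : f.app _ b = g.app _ b := by
    subst hab
    exact congr(($(h i)).app _ a)
  apply complex_hom_ext
  · exact hb
  · exact fun r => key _ _ _ _ (complexIncl_centre r.1 r.2)
  · exact fun x => key _ _ _ _ (complexIncl_loop x.1 x.2)
  · exact fun c => key _ _ _ _ (complexIncl_spoke c.1.1 (sideProj c))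
  · exact fun c => key _ _ _ _ (complexIncl_cone c.1.1 (sideProj c))

variable (P) in
/-- The complex of a disjoint union of presentations is the wedge of the complexes: its cells are
those of the summands, except that there is a single base point. -/
noncomputable def wedgeIso :
    SSet.wedge (fun i => (P i).complex) (fun i => (P i).basePt) ≅ (sigma P).complex where
  hom := SSet.wedgeDesc (sigma P).basePt (complexIncl P) complexIncl_basePt
  inv := sigmaDesc _ (SSet.wedgeIncl _ _) (SSet.wedgeIncl_pt _ _)
  hom_inv_id := by
    apply SSet.wedge_hom_ext
    · exact (congrArg ((sigmaDesc _ (SSet.wedgeIncl _ _) (SSet.wedgeIncl_pt _ _)).app _)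
        (SSet.wedgeDesc_pt _ _ _)).trans (sigmaDesc_basePt _ _ _)
    · intro i
      exact (Category.assoc _ _ _).symm.trans
        ((congrArg (· ≫ _) (SSet.wedgeIncl_wedgeDesc _ _ _ i)).trans
          ((complexIncl_sigmaDesc _ _ _ i).trans (Category.comp_id _).symm))
  inv_hom_id := by
    apply sigma_hom_ext
    · exact (congrArg ((SSet.wedgeDesc (sigma P).basePt (complexIncl P) complexIncl_basePt).app _)
        (sigmaDesc_basePt _ _ _)).trans (SSet.wedgeDesc_pt _ _ _)
    · intro i
      exact (Category.assoc _ _ _).symm.trans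
        ((congrArg (· ≫ _) (complexIncl_sigmaDesc _ _ _ i)).trans
          ((SSet.wedgeIncl_wedgeDesc _ _ _ i).trans (Category.comp_id _).symm))

lemma wedgeIso_hom_wedgePt :
    (wedgeIso P).hom.app _ (SSet.wedgePt (fun i => (P i).complex) (fun i => (P i).basePt)) =
      (sigma P).basePt :=
  SSet.wedgeDesc_pt _ _ complexIncl_basePt

end GroupPresentation

/-! ### Invariance under isomorphisms -/

lemma CategoryTheory.Limits.IsZero.kernel {C : Type*} [Category* C] [HasZeroMorphisms C]
    {A B : C} (h : IsZero A) (f : A ⟶ B) [HasKernel f] : IsZero (kernel f) :=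
  h.of_mono (kernel.ι f)

namespace SSet

section iso

variable {X Y : SSet.{0}} (e : X ≅ Y)

/-- The fundamental groupoid as a functor. -/
noncomputable def fundamentalGroupoidFunctor : SSet.{0} ⥤ Cat.{0, 0} :=
  truncation 2 ⋙ Truncated.hoFunctor₂ ⋙ Grpd.free ⋙ Grpd.forgetToCat

/-- Isomorphic pointed simplicial sets have isomorphic fundamental groups. -/
noncomputable def fundamentalGroupEquivOfIso (x : X.Vertex) :
    X.FundamentalGroup x ≃* Y.FundamentalGroup (e.hom.app _ x) :=
  let E := Cat.equivOfIso (fundamentalGroupoidFunctor.mapIso e)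
  (Functor.FullyFaithful.autMulEquivOfFullyFaithful E.fullyFaithfulFunctor (FreeGroupoid.mk
      (SSet.Truncated.HomotopyCategory.mk (V := (SSet.truncation 2).obj X) x)) :)

variable (R : Type) [CommRing R]

/-- Isomorphic simplicial sets have isomorphic homology. -/
noncomputable def homologyIsoOfIso (n : ℕ) :
    X.homology (ModuleCat.of R R) n ≅ Y.homology (ModuleCat.of R R) n :=
  (homologyFunctor (ModuleCat.of R R) n).mapIso e

/-- Isomorphic simplicial sets have isomorphic reduced homology. -/
noncomputable def reducedHomologyIsoOfIso (n : ℕ) :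
    X.reducedHomology R n ≅ Y.reducedHomology R n :=
  kernelIsoOfEq ((congrArg (fun f => SSet.homologyMap f (ModuleCat.of R R) n)
    (stdSimplex.isTerminalObj₀.hom_ext _ _)).trans (homologyMap_comp (f := e.hom) ..)) ≪≫
  kernelIsIsoComp (homologyIsoOfIso e R n).hom
    (SSet.homologyMap (stdSimplex.isTerminalObj₀.from Y) (ModuleCat.of R R) n)

lemma IsMooreSpace.of_iso {x : X.Vertex} {y : Y.Vertex} (hxy : e.hom.app _ x = y)
    {G H : Type} [Group G] [Group H] (h : Y.IsMooreSpace y G) (f : G ≃* H) :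
    X.IsMooreSpace x H := by
  subst hxy
  exact ⟨h.1.map fun φ => (fundamentalGroupEquivOfIso e x).trans (φ.trans f),
    fun n hn => (h.2 n hn).of_iso (reducedHomologyIsoOfIso e ℤ n)⟩

end iso

lemma IsHomologyAcyclic.of_iso {X Y : SSet.{0}} (e : X ≅ Y) {R : Type} [CommRing R]
    (h : Y.IsHomologyAcyclic R) :
    X.IsHomologyAcyclic R :=
  ⟨h.1.map (e.inv.app _), fun n => (h.2 n).of_iso (reducedHomologyIsoOfIso e R n)⟩

variable (X : SSet.{0}) (R : Type) [CommRing R]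

lemma isZero_reducedHomology {n : ℕ} (h : IsZero (X.homology (ModuleCat.of R R) n)) :
    IsZero (X.reducedHomology R n) :=
  h.kernel _

/-- The augmentation is natural. -/
lemma homologyMap_homology₀ε {X Y : SSet.{0}} (f : X ⟶ Y) :
    SSet.homologyMap f (ModuleCat.of R R) 0 ≫ Y.homology₀ε (ModuleCat.of R R) =
      X.homology₀ε (ModuleCat.of R R) := by
  have hlift (Z : SSet.{0}) (z : Z.Vertex) :
      Z.ιChainComplex z ≫ ((Z.chainComplex (ModuleCat.of R R)).iCyclesIso 0 0 (by simp)
        (by simp)).inv = (Z.chainComplex (ModuleCat.of R R)).liftCycles (Z.ιChainComplex z) 0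
          (by simp) (by simp) := by
    rw [Iso.comp_inv_eq]
    exact (HomologicalComplex.liftCycles_i ..).symm
  rw [← cancel_epi ((X.chainComplex (ModuleCat.of R R)).homologyπ 0),
    ← cancel_epi ((X.chainComplex (ModuleCat.of R R)).iCyclesIso 0 0 (by simp) (by simp)).inv]
  refine chainComplex_hom_ext fun x => ?_
  rw [reassoc_of% hlift X x, reassoc_of% hlift X x,
    liftCycles_ιChainComplex_homologyπ_homology₀ε, HomologicalComplex.homologyπ_naturality_assoc,
    HomologicalComplex.liftCycles_comp_cyclesMap_assoc]
  simp only [ι_chainComplexMap_f]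
  exact liftCycles_ιChainComplex_homologyπ_homology₀ε _ _ _

/-- For a connected simplicial set the augmentation is an isomorphism, and it factors through the
homology of a point. -/
lemma isZero_reducedHomology_zero [X.IsConnected] : IsZero (X.reducedHomology R 0) := by
  let f := stdSimplex.isTerminalObj₀.from X
  have : Mono (SSet.homologyMap f (ModuleCat.of R R) 0) := by
    have : Mono (SSet.homologyMap f (ModuleCat.of R R) 0 ≫ homology₀ε _ (ModuleCat.of R R)) := by
      rw [homologyMap_homology₀ε]; infer_instance
    exact mono_of_mono _ (homology₀ε _ (ModuleCat.of R R))
  exact isZero_kernel_of_mono (SSet.homologyMap f (ModuleCat.of R R) 0)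

end SSet

namespace GroupPresentation

variable (P : GroupPresentation)

/-- A presentation complex is connected, as spokes join the centres of the 2-cells to the base
point. -/
instance : P.complex.IsConnected := by
  have h (x : P.complex.Vertex) : SSet.π₀.mk P.basePt = SSet.π₀.mk x := by
    obtain ⟨v, rfl⟩ := DeltaComplex2.vertex_surjective (K := P.cells) x
    rcases v with _ | s
    · rfl
    · exact (SSet.π₀.sound (spokeEdge s ⟨0, word_length_pos s⟩)).symm
  exact (SSet.isConnected_iff _).2 ⟨⟨fun a b => by
    obtain ⟨x, rfl⟩ := SSet.π₀.mk_surjective a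
    obtain ⟨y, rfl⟩ := SSet.π₀.mk_surjective b
    rw [← h x, ← h y]⟩, ⟨P.basePt⟩⟩

/-- If the exponent vectors of the relators are linearly independent, then the reduced homology of
the presentation complex vanishes outside degree one. -/
lemma isZero_reducedHomology_complex (R : Type) [CommRing R]
    (h : Function.Injective (relatorMap P R)) {n : ℕ} (hn : n ≠ 1) :
    IsZero (P.complex.reducedHomology R n) := by
  match n with
  | 0 => exact SSet.isZero_reducedHomology_zero _ _
  | 1 => exact absurd rfl hn
  | 2 => exact SSet.isZero_reducedHomology _ _ (isZero_homology_two R h)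
  | n + 3 =>
    have : P.complex.HasDimensionLT 3 := inferInstanceAs (P.cells.toSSet.HasDimensionLT 3)
    exact SSet.isZero_reducedHomology _ _ (SSet.isZero_homology_of_hasDimensionLT _ _ _ 3)

end GroupPresentation

/-! ### Free products -/

namespace GroupPresentation

lemma lift_word_eq_one (P : GroupPresentation) {G : Type*} [Group G] (φ : P.group →* G)
    (s : P.Rel) :
    FreeGroup.lift (fun x => φ (PresentedGroup.of x)) (FreeGroup.mk (P.word s)) = 1 := by
  have h : FreeGroup.lift (fun x => φ (PresentedGroup.of x)) = φ.comp (PresentedGroup.mk _) := by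
    ext x
    exact FreeGroup.lift_apply_of
  rw [h, MonoidHom.comp_apply, PresentedGroup.one_of_mem (Set.mem_range_self s), map_one]

variable {ι : Type} (P : ι → GroupPresentation)

lemma lift_word_sigma {G : Type*} [Group G] (f : (sigma P).Gen → G) (i : ι) (s : (P i).Rel) :
    FreeGroup.lift f (FreeGroup.mk ((sigma P).word ⟨i, s⟩)) =
      FreeGroup.lift (fun x => f ⟨i, x⟩) (FreeGroup.mk ((P i).word s)) := by
  rw [FreeGroup.lift_mk, FreeGroup.lift_mk]
  exact congrArg List.prod List.map_map

/-- The homomorphism from the group of a disjoint union to the free product. -/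
def sigmaToCoprod : (sigma P).group →* Monoid.CoprodI fun i => (P i).group :=
  PresentedGroup.toGroup (f := fun x : (sigma P).Gen =>
    Monoid.CoprodI.of (M := fun i => (P i).group) (i := x.1) (PresentedGroup.of x.2)) (by
    rintro _ ⟨s, rfl⟩
    exact (lift_word_sigma P _ s.1 s.2).trans ((P s.1).lift_word_eq_one
      (Monoid.CoprodI.of (M := fun i => (P i).group)) s.2))

lemma sigmaToCoprod_of (i : ι) (x : (P i).Gen) :
    sigmaToCoprod P (PresentedGroup.of ⟨i, x⟩) =
      Monoid.CoprodI.of (M := fun i => (P i).group) (i := i) (PresentedGroup.of x) :=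
  PresentedGroup.toGroup.of _

/-- The homomorphism from the group of one presentation to the group of a disjoint union. -/
def toSigma (i : ι) : (P i).group →* (sigma P).group :=
  PresentedGroup.toGroup (f := fun x => PresentedGroup.of (⟨i, x⟩ : (sigma P).Gen)) (by
    rintro _ ⟨s, rfl⟩
    exact (lift_word_sigma P PresentedGroup.of i s).symm.trans
      ((sigma P).lift_word_eq_one (MonoidHom.id _) ⟨i, s⟩))

lemma toSigma_of (i : ι) (x : (P i).Gen) :
    toSigma P i (PresentedGroup.of x) = PresentedGroup.of (⟨i, x⟩ : (sigma P).Gen) :=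
  PresentedGroup.toGroup.of _

/-- The group of a disjoint union of presentations is the free product of the groups. -/
def sigmaGroupEquiv : (sigma P).group ≃* Monoid.CoprodI fun i => (P i).group :=
  MonoidHom.toMulEquiv (sigmaToCoprod P) (Monoid.CoprodI.lift (toSigma P))
    (PresentedGroup.ext fun x => (congrArg _ (sigmaToCoprod_of P x.1 x.2)).trans
      ((Monoid.CoprodI.lift_of _ _).trans (toSigma_of P x.1 x.2)))
    (Monoid.CoprodI.ext_hom _ _ fun i => PresentedGroup.ext fun x =>
      (congrArg (sigmaToCoprod P) ((Monoid.CoprodI.lift_of _ _).trans (toSigma_of P i x))).trans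
        (sigmaToCoprod_of P i x))

end GroupPresentation

/-! ### Diagonal presentations -/

namespace GroupPresentation

variable {P : GroupPresentation}

/-- If the exponent vectors of the relators are linearly independent over `ℤ`, then the presentation
complex is a Moore space. -/
theorem isMooreSpace_complex (h : Function.Injective (relatorMap P ℤ)) :
    P.complex.IsMooreSpace P.basePt P.group :=
  ⟨nonempty_fundamentalGroup_equiv P, fun _ hn => P.isZero_reducedHomology_complex ℤ h hn⟩

/-- If the exponent vectors of the relators form a basis, then the presentation complex is
acyclic. -/
theorem isHomologyAcyclic_complex {R : Type} [CommRing R]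
    (h : Function.Bijective (relatorMap P R)) : P.complex.IsHomologyAcyclic R := by
  refine ⟨⟨P.basePt⟩, fun n => ?_⟩
  by_cases hn : n = 1
  · subst hn
    obtain ⟨e⟩ := nonempty_homology_one_equiv R (0 : (P.Gen →₀ R) →ₗ[R] PUnit)
      (fun _ => ⟨0, rfl⟩) (by rw [LinearMap.ker_zero, LinearMap.range_eq_top.2 h.2])
    have := e.toEquiv.subsingleton
    exact SSet.isZero_reducedHomology _ _ (ModuleCat.isZero_of_subsingleton _)
  · exact P.isZero_reducedHomology_complex R h.1 hn

lemma exponents_map {A B : Type} (R : Type) [CommRing R] (f : A → B) (w : List (A × Bool)) :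
    exponents R (w.map fun l => (f l.1, l.2)) = Finsupp.mapDomain f (exponents R w) := by
  induction w with
  | nil => simp [exponents]
  | cons a w ih =>
    simp only [exponents, List.map_cons, List.sum_cons] at ih ⊢
    rw [ih, Finsupp.mapDomain_add, Finsupp.mapDomain_single]

/-- The abelianized relators of the presentation are multiples of the generators, matched up by a
bijection `e` between relators and generators: the relator matched with the generator `x` becomes
`d x` times `x`. -/
structure IsDiagonal (P : GroupPresentation) (e : P.Rel ≃ P.Gen) (d : P.Gen → ℕ) : Prop where
  exponents_word : ∀ (R : Type) [CommRing R] (s : P.Rel),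
    exponents R (P.word s) = Finsupp.single (e s) (d (e s) : R)

namespace IsDiagonal

variable {e : P.Rel ≃ P.Gen} {d : P.Gen → ℕ}

lemma relatorMap_apply (hP : P.IsDiagonal e d) (R : Type) [CommRing R] (z : P.Rel →₀ R)
    (s : P.Rel) :
    relatorMap P R z (e s) = z s * d (e s) := by
  rw [relatorMap, Finsupp.linearCombination_apply, Finsupp.sum, Finsupp.finsetSum_apply]
  classical
  simp_rw [hP.exponents_word, Finsupp.smul_apply, Finsupp.single_apply, e.injective.eq_iff]
  by_cases hs : s ∈ z.support
  · simp [hs]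
  · simp_all

lemma relatorMap_injective (hP : P.IsDiagonal e d) (R : Type) [CommRing R] [IsDomain R]
    [CharZero R] (hd : ∀ x, d x ≠ 0) :
    Function.Injective (relatorMap P R) := by
  rw [← LinearMap.ker_eq_bot, LinearMap.ker_eq_bot']
  intro z hz
  ext s
  have := hP.relatorMap_apply R z s
  rw [hz] at this
  simpa [hd] using this.symm

lemma mem_range_relatorMap (hP : P.IsDiagonal e d) (R : Type) [CommRing R] (w : P.Gen →₀ R) :
    w ∈ LinearMap.range (relatorMap P R) ↔ ∀ x, (d x : R) ∣ w x := by
  constructor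
  · rintro ⟨z, rfl⟩ x
    obtain ⟨s, rfl⟩ := e.surjective x
    exact ⟨z s, by rw [hP.relatorMap_apply, mul_comm]⟩
  · intro h
    induction w using Finsupp.induction with
    | zero => exact zero_mem _
    | single_add x b w hx hb ih =>
      refine add_mem ?_ (ih fun y => ?_)
      · obtain ⟨s, rfl⟩ := e.surjective x
        obtain ⟨c, hc⟩ := h (e s)
        rw [Finsupp.add_apply, Finsupp.single_eq_same, Finsupp.notMem_support_iff.1 hx,
          add_zero] at hc
        refine ⟨Finsupp.single s c, ?_⟩
        rw [relatorMap, Finsupp.linearCombination_single, hP.exponents_word,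
          Finsupp.smul_single, hc, smul_eq_mul, mul_comm]
      · by_cases hy : y = x
        · subst hy; simp [Finsupp.notMem_support_iff.1 hx]
        · simpa [Finsupp.single_apply, Ne.symm hy] using h y

/-- The first homology of the complex of a diagonal presentation is a direct sum of cyclic
groups. -/
theorem nonempty_integralHomology_one_equiv (hP : P.IsDiagonal e d) :
    Nonempty (P.complex.integralHomology 1 ≃+ ⨁ x, ZMod (d x)) := by
  classical
  -- The reduction of each coordinate, whose kernel is the image of the relator map.
  let q : (P.Gen →₀ ℤ) →ₗ[ℤ] ⨁ x, ZMod (d x) := Finsupp.lsum ℤ fun x =>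
    DirectSum.lof ℤ P.Gen (fun x => ZMod (d x)) x ∘ₗ (Int.castAddHom (ZMod (d x))).toIntLinearMap
  have hq (w : P.Gen →₀ ℤ) (x : P.Gen) : q w x = (w x : ZMod (d x)) := by
    induction w using Finsupp.induction_linear with
    | zero => simp
    | add v w hv hw => simp [map_add, hv, hw]
    | single y a =>
      simp only [q, Finsupp.lsum_single, LinearMap.comp_apply, DirectSum.lof_eq_of]
      by_cases h : y = x
      · subst h; simp
      · rw [DirectSum.of_eq_of_ne _ _ _ (Ne.symm h), Finsupp.single_eq_of_ne (Ne.symm h)]; simp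
  obtain ⟨f⟩ := nonempty_homology_one_equiv ℤ q (fun a => by
    induction a using DirectSum.induction_on with
    | zero => exact ⟨0, map_zero q⟩
    | of x a =>
      obtain ⟨n, rfl⟩ := ZMod.intCast_surjective a
      exact ⟨Finsupp.single x n, by simp [q]; rfl⟩
    | add a b ha hb =>
      obtain ⟨v, rfl⟩ := ha
      obtain ⟨w, rfl⟩ := hb
      exact ⟨v + w, map_add q v w⟩) (by
    ext w
    rw [LinearMap.mem_ker, hP.mem_range_relatorMap]
    refine DFinsupp.ext_iff.trans (forall_congr' fun x => ?_)
    rw [hq]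
    exact ZMod.intCast_zmod_eq_zero_iff_dvd _ _)
  exact ⟨f.toAddEquiv⟩

/-- A disjoint union of diagonal presentations is diagonal. -/
lemma sigma {ι : Type} {P : ι → GroupPresentation}
    {e : ∀ i, (P i).Rel ≃ (P i).Gen} {d : ∀ i, (P i).Gen → ℕ}
    (h : ∀ i, (P i).IsDiagonal (e i) (d i)) :
    (GroupPresentation.sigma P).IsDiagonal (Equiv.sigmaCongrRight e) fun x => d x.1 x.2 where
  exponents_word R _ s := by
    refine (exponents_map R (Sigma.mk s.1) _).trans ?_
    rw [(h s.1).exponents_word, Finsupp.mapDomain_single]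
    rfl

end IsDiagonal

end GroupPresentation

/-! ### The presentations of the groups `G(r, n)` -/

open GroupPresentation

namespace LayerSequences

variable {J : Set ℕ} (D : LayerSequences J)

/-- Only the power `x(l)^{r(l)}` contributes to the exponents, since each commutator has exponent
sum zero in every generator. -/
lemma exponents_relatorWord (R : Type) [CommRing R] (l : D.Index) :
    exponents R (D.relatorWord l) = Finsupp.single l (D.r l : R) := by
  have h1 : exponents R (List.replicate (D.r l) (l, true)) = Finsupp.single l (D.r l : R) := by
    simp [exponents]
  have h2 (L : List (Fin (D.n l.1))) : exponents R (L.flatMap (D.commutatorWord l)) = 0 := by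
    induction L with
    | nil => rfl
    | cons a L ih =>
      rw [List.flatMap_cons, exponents_append, ih, add_zero]
      simp [commutatorWord, exponents]
  rw [relatorWord, exponents_append, h1, h2, add_zero]

end LayerSequences

/-! ### Torsion numbers and sums of cyclic groups -/

section torsion

variable {J : Set ℕ}

lemma one_mem_torsionNumbers : 1 ∈ torsionNumbers J :=
  ⟨one_ne_zero, fun _ hp h => absurd (Nat.dvd_one.1 h) hp.ne_one⟩

lemma mul_mem_torsionNumbers {a b : ℕ} (ha : a ∈ torsionNumbers J) (hb : b ∈ torsionNumbers J) :
    a * b ∈ torsionNumbers J :=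
  ⟨mul_ne_zero ha.1 hb.1, fun p hp h => (hp.dvd_mul.1 h).elim (ha.2 p hp) (hb.2 p hp)⟩

lemma pow_mem_torsionNumbers {q : ℕ} (hq : q.Prime) (hqJ : q ∈ J) (e : ℕ) :
    q ^ e ∈ torsionNumbers J :=
  ⟨pow_ne_zero e hq.ne_zero, fun _ hp h => (Nat.prime_eq_prime_of_dvd_pow hp hq h) ▸ hqJ⟩

/-- The numbers in `ℕ(J)` are invertible in `ℤ[J⁻¹]`. -/
lemma isUnit_natCast_invertedIntegers {m : ℕ} (hm : m ∈ torsionNumbers J) :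
    IsUnit (m : invertedIntegers J) := by
  induction m using induction_on_primes with
  | zero => exact absurd rfl hm.1
  | one => simp
  | prime_mul p a hp ih =>
    rw [Nat.cast_mul]
    refine IsUnit.mul ?_ (ih ⟨right_ne_zero_of_mul hm.1, fun q hq h => hm.2 q hq (h.mul_left p)⟩)
    have hpJ : p ∈ J := hm.2 p hp (dvd_mul_right p a)
    refine IsUnit.of_mul_eq_one ⟨(p : ℚ)⁻¹, Subring.subset_closure ⟨p, hpJ, rfl⟩⟩ ?_
    ext
    simp [hp.ne_zero]

lemma exists_torsionNumber_smul_eq_zero {I : Type} {d : I → ℕ} (hd : ∀ x, d x ∈ torsionNumbers J)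
    (a : ⨁ x, ZMod (d x)) : ∃ m ∈ torsionNumbers J, m • a = 0 := by
  classical
  induction a using DirectSum.induction_on with
  | zero => exact ⟨1, one_mem_torsionNumbers, smul_zero _⟩
  | of x a => exact ⟨d x, hd x, by rw [← map_nsmul]; simp⟩
  | add a b ha hb =>
    obtain ⟨m, hm, hma⟩ := ha
    obtain ⟨n, hn, hnb⟩ := hb
    exact ⟨m * n, mul_mem_torsionNumbers hm hn, by
      rw [smul_add, mul_comm m n, mul_smul, hma, mul_comm n m, mul_smul, hnb, smul_zero, smul_zero,
        add_zero]⟩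

/-- A direct sum of finite cyclic groups is a direct sum of cyclic groups of prime power order. -/
noncomputable def directSumZModEquiv {I : Type} (d : I → ℕ) (hd : ∀ x, d x ≠ 0) :
    (⨁ x, ZMod (d x)) ≃+
      ⨁ i : Σ x, (d x).primeFactors, ZMod ((i.2 : ℕ) ^ (d i.1).factorization i.2) := by
  classical
  exact (DFinsupp.mapRange.addEquiv fun x => (ZMod.equivPi _ (hd x)).toAddEquiv.trans
    (DirectSum.addEquivProd _).symm).trans
      (DirectSum.sigmaCurryEquiv (δ := fun x (p : (d x).primeFactors) =>
        ZMod ((p : ℕ) ^ (d x).factorization p))).symm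

end torsion

namespace LayerSequences

variable {J : Set ℕ} (D : LayerSequences J)

/-- The relator map of `M(r, n)` is the diagonal matrix of the numbers `r(l)`. -/
lemma isDiagonal_presentation : D.presentation.IsDiagonal (Equiv.refl D.Index) D.r :=
  ⟨fun R _ l => D.exponents_relatorWord R l⟩

/-- The choice with `m` commutators in the relator of the root, no commutators in the relators of
its `2 * m` successors, and all exponents equal to `q ^ e`. The number `m` is a free parameter which
makes infinitely many such choices available. -/
def primePower {q : ℕ} (hq : q.Prime) (hqJ : q ∈ J) (e m : ℕ) : LayerSequences J where
  n l := if l = [] then m else 0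
  n_eq_zero l hl := if_neg fun h => hl (by rw [h]; exact .root)
  r _ := q ^ e
  r_mem _ := pow_mem_torsionNumbers hq hqJ e

end LayerSequences

namespace GroupPresentation.IsDiagonal

variable {J : Set ℕ} {P : GroupPresentation} {e : P.Rel ≃ P.Gen} {d : P.Gen → ℕ}

lemma isMooreSpace_complex (hP : P.IsDiagonal e d) (hd : ∀ x, d x ∈ torsionNumbers J) :
    P.complex.IsMooreSpace P.basePt P.group :=
  GroupPresentation.isMooreSpace_complex (hP.relatorMap_injective ℤ fun x => (hd x).1)

lemma isHomologyAcyclic_complex (hP : P.IsDiagonal e d) (hd : ∀ x, d x ∈ torsionNumbers J) :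
    P.complex.IsHomologyAcyclic (invertedIntegers J) := by
  refine GroupPresentation.isHomologyAcyclic_complex
    ⟨hP.relatorMap_injective _ fun x => (hd x).1, LinearMap.range_eq_top.1 ?_⟩
  refine Submodule.eq_top_iff'.2 fun w => (hP.mem_range_relatorMap _ w).2 fun x => ?_
  exact (isUnit_natCast_invertedIntegers (hd x)).dvd

end GroupPresentation.IsDiagonal

theorem mainTheorem6 (J : Set ℕ) (hJ : ∀ p ∈ J, p.Prime) :
    (∀ D : LayerSequences J,
      D.M.IsMooreSpace D.basePt D.G ∧
      IsZero (D.M.integralHomology 2) ∧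
      (∀ a : D.M.integralHomology 1, ∃ m ∈ torsionNumbers J, m • a = 0) ∧
      D.M.IsHomologyAcyclic (invertedIntegers J)) ∧
    (universalMooreSpace J).IsMooreSpace (universalMooreSpacePt J) (universalGroup J) ∧
    (universalMooreSpace J).IsHomologyAcyclic (invertedIntegers J) ∧
    ∃ (ι : Type) (p k : ι → ℕ),
      (∀ i, p i ∈ J ∧ 1 ≤ k i) ∧
      (∀ q ∈ J, ∀ e : ℕ, 1 ≤ e → {i | p i = q ∧ k i = e}.Infinite) ∧
      Nonempty ((universalMooreSpace J).integralHomology 1 ≃+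
        ⨁ i, ZMod (p i ^ k i)) := by
  -- The wedge is the complex of the disjoint union of all presentations, which is again diagonal,
  -- with the entry `r(l)` for each choice of sequences and each multi-index `l` of that choice.
  let P (D : LayerSequences J) : GroupPresentation := D.presentation
  have hP : (GroupPresentation.sigma P).IsDiagonal _ _ :=
    IsDiagonal.sigma fun D : LayerSequences J => D.isDiagonal_presentation
  let d (x : Σ D : LayerSequences J, D.Index) : ℕ := x.1.r x.2
  have hd (x : Σ D : LayerSequences J, D.Index) : d x ∈ torsionNumbers J := x.1.r_mem x.2
  refine ⟨fun D => ⟨D.isDiagonal_presentation.isMooreSpace_complex D.r_mem,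
      isZero_homology_two ℤ (D.isDiagonal_presentation.relatorMap_injective ℤ
        fun x => (D.r_mem x).1), fun a => ?_,
      D.isDiagonal_presentation.isHomologyAcyclic_complex D.r_mem⟩,
    SSet.IsMooreSpace.of_iso (wedgeIso P) wedgeIso_hom_wedgePt (hP.isMooreSpace_complex hd)
      (sigmaGroupEquiv P),
    SSet.IsHomologyAcyclic.of_iso (wedgeIso P) (hP.isHomologyAcyclic_complex hd),
    Σ x, (d x).primeFactors, fun i => i.2, fun i => (d i.1).factorization i.2,
    fun i => ⟨?_, ?_⟩, fun q hq e he => ?_, ?_⟩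
  · obtain ⟨f⟩ := D.isDiagonal_presentation.nonempty_integralHomology_one_equiv
    obtain ⟨m, hm, hma⟩ := exists_torsionNumber_smul_eq_zero D.r_mem (f a)
    exact ⟨m, hm, f.injective ((map_nsmul f m a).trans (hma.trans (map_zero f).symm))⟩
  · exact (hd i.1).2 _ (Nat.prime_of_mem_primeFactors i.2.2) (Nat.dvd_of_mem_primeFactors i.2.2)
  · exact (Nat.prime_of_mem_primeFactors i.2.2).factorization_pos_of_dvd (hd i.1).1
      (Nat.dvd_of_mem_primeFactors i.2.2)
  -- The roots of the choices `primePower` with `m = 0, 1, 2, …` each contribute `ℤ/q^e`.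
  · have hmem (m : ℕ) : q ∈ (d ⟨.primePower (hJ q hq) hq e m, [], .root⟩).primeFactors :=
      (Nat.mem_primeFactors_of_ne_zero (hd _).1).2
        ⟨hJ q hq, dvd_pow_self q (Nat.one_le_iff_ne_zero.1 he)⟩
    refine Set.infinite_of_injective_forall_mem
      (f := fun m : ℕ => ⟨⟨.primePower (hJ q hq) hq e m, [], .root⟩, q, hmem m⟩)
      (fun m m' h => ?_) fun m => ⟨rfl, ?_⟩
    · have := congrArg (fun i => i.1.1.n []) h
      simpa [LayerSequences.primePower] using this
    · change (q ^ e).factorization q = e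
      simp [(hJ q hq).factorization_self]
  · obtain ⟨f⟩ := hP.nonempty_integralHomology_one_equiv
    exact ⟨((SSet.homologyIsoOfIso (wedgeIso P) ℤ 1).toLinearEquiv.toAddEquiv.trans f).trans
      (directSumZModEquiv d fun x => (hd x).1)⟩
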